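/- Let $M$ be a smooth $4$-dimensional manifold, $\alpha$ a smooth pseudo-Riemannian metric on $M$ (of any signature), $\beta$ a smooth one-form on $M$, and $c,m,p\in\mathbb{R}$. Let $(M,L)$ be a Finsler spacetime: $L$ is a smooth real function on a conic subbundle $\mathcal{A}\subset TM\setminus\{0\}$ (a nonempty open set projecting onto $M$ and stable under $\dot x\mapsto\lambda\dot x$, $\lambda>0$), positively $2$-homogeneous in $\dot x$, with $g^L_{ab}=\frac12\dot\partial_a\dot\partial_bL$ nondegenerate on $\mathcal{A}$ (where $\partial_a=\partial/\partial x^a$, $\dot\partial_a=\partial/\partial\dot x^a$), and there is a conic subbundle $\mathcal{T}\subset\mathcal{A}$ on which $L>0$ and $g^L$ has signature $(+,-,-,-)$, with $L$ extending continuously by $0$ to $\partial\mathcal{T}$. Assume that on $\mathcal{A}$ $$L(x,\dot x)=\alpha(\dot x,\dot x)\,s^{-p}(c+ms)^{p+1},\qquad s=\frac{\beta(\dot x)^2}{\alpha(\dot x,\dot x)},$$ where at vectors at which the right-hand side is not literally defined (for instance $\alpha(\dot x,\dot x)=0$) it is read as the equal expression $\big(c\,\alpha(\dot x,\dot x)+m\,\beta(\dot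 x)^2\big)^{p+1}\big/(\beta(\dot x)^2)^{p}$. Assume moreover that the smooth function $H:M\to\mathbb{R}$ satisfies the Berwald condition $$\nabla_a\beta_b=H\Big(\big[c(1-p)+m\,\alpha^{-1}(\beta,\beta)\big]\beta_a\beta_b+c\,p\,\alpha^{-1}(\beta,\beta)\,\alpha_{ab}\Big),$$ where $\nabla$ is the Levi-Civita connection of $\alpha$. Let $G^a=\frac14 g^{L\,aq}(\dot x^m\partial_m\dot\partial_qL-\partial_qL)$ be the geodesic spray coefficients, $\delta_a=\partial_a-(\dot\partial_aG^b)\dot\partial_b$, $\Gamma^a{}_{bc}=\frac12 g^{L\,aq}(\delta_bg^L_{cq}+\delta_cg^L_{bq}-\delta_qg^L_{bc})$ the Chern–Rund connection coefficients, and $R_{ab}=\delta_m\Gamma^m{}_{ab}-\delta_b\Gamma^m{}_{am}+\Gamma^m{}_{ms}\Gamma^s{}_{ab}-\Gamma^m{}_{bs}\Gamma^s{}_{am}$ the horizontal Chern–Rund Ricci tensor, all on $\mathcal{A}$ and in local coordinates. Then: 1. $(M,L)$ is of Berwald type: in every chart $G^a(x,\dot x)=\frac12G^a{}_{bc}(x)\dot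 x^b\dot x^c$ on $\mathcal{A}$ for some functions $G^a{}_{bc}$ of $x$ only. 2. In every chart, at every $(x,\dot x)\in\mathcal{A}$, $$\tfrac12(R_{ab}-R_{ba})=f\,(\beta_a\partial_bH-\beta_b\partial_aH),\qquad f=\tfrac12\big(4cp-m\,\alpha^{-1}(\beta,\beta)\big),$$ that is, the skew-symmetric part of the Chern–Rund Ricci tensor is $f\,\beta\wedge dH$. 3. If there is a point of $M$ at which $f\neq0$ and $\beta\wedge dH\neq0$, then $(M,L)$ is non-metrizable: there is no pseudo-Riemannian metric $g$ on $M$ (of any signature) whose Christoffel symbols equal $\Gamma^a{}_{bc}$ in every chart at all points of $\mathcal{A}$. -/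

import Mathlib

open Set Filter Topology Bundle
open scoped Manifold ContDiff

noncomputable section

namespace BerwaldSpacetime

/-- The model space `ℝⁿ`. -/
abbrev E (n : ℕ) : Type := EuclideanSpace ℝ (Fin n)

/-- The standard basis vectors of `ℝⁿ`. -/
def stdVec {n : ℕ} (a : Fin n) : E n := EuclideanSpace.single a 1

/-- The partial derivative `∂F/∂yᵃ` of a function on `ℝⁿ`. -/
def pd {n : ℕ} (a : Fin n) (F : E n → ℝ) (y : E n) : ℝ := fderiv ℝ F y (stdVec a)

/-! ### Finsler geometry in one coordinate chart

A function `F : E n → E n → ℝ` stands for a function `F(x, ẋ)` of the manifold induced coordinates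
of the tangent bundle. -/

/-- `∂ₐ = ∂/∂xᵃ`. -/
def dx {n : ℕ} (a : Fin n) (F : E n → E n → ℝ) (x v : E n) : ℝ := pd a (fun x' => F x' v) x

/-- `∂̇ₐ = ∂/∂ẋᵃ`. -/
def dv {n : ℕ} (a : Fin n) (F : E n → E n → ℝ) (x v : E n) : ℝ := pd a (F x) v

/-- The `L`-metric `g_{ab} = ½ ∂̇ₐ ∂̇_b L`. -/
def lMetric {n : ℕ} (L : E n → E n → ℝ) (x v : E n) : Matrix (Fin n) (Fin n) ℝ :=
  Matrix.of fun a b => (1 / 2) * dv a (dv b L) x v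

/-- The geodesic spray coefficients `Gᵃ = ¼ g^{aq} (ẋᵐ ∂ₘ ∂̇_q L - ∂_q L)`. -/
def spray {n : ℕ} (L : E n → E n → ℝ) (a : Fin n) (x v : E n) : ℝ :=
  (1 / 4) * ∑ q, (lMetric L x v)⁻¹ a q * ((∑ m, v m * dx m (dv q L) x v) - dx q L x v)

/-- The horizontal derivative `δₐ = ∂ₐ - (∂̇ₐ Gᵇ) ∂̇_b`. -/
def hor {n : ℕ} (L : E n → E n → ℝ) (a : Fin n) (F : E n → E n → ℝ) (x v : E n) : ℝ :=
  dx a F x v - ∑ b, dv a (spray L b) x v * dv b F x v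

/-- The Chern–Rund connection coefficients
`Γᵃ_{bc} = ½ g^{aq} (δ_b g_{cq} + δ_c g_{bq} - δ_q g_{bc})`. -/
def chernRund {n : ℕ} (L : E n → E n → ℝ) (a b c : Fin n) (x v : E n) : ℝ :=
  (1 / 2) * ∑ q, (lMetric L x v)⁻¹ a q *
    (hor L b (fun x' v' => lMetric L x' v' c q) x v
      + hor L c (fun x' v' => lMetric L x' v' b q) x v
      - hor L q (fun x' v' => lMetric L x' v' b c) x v)

/-- The horizontal Chern–Rund Ricci tensor
`R_{ab} = δₘ Γᵐ_{ab} - δ_b Γᵐ_{am} + Γᵐ_{ms} Γˢ_{ab} - Γᵐ_{bs} Γˢ_{am}`. -/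
def chernRundRicci {n : ℕ} (L : E n → E n → ℝ) (a b : Fin n) (x v : E n) : ℝ :=
  (∑ m, hor L m (chernRund L m a b) x v) - (∑ m, hor L b (chernRund L m a m) x v)
    + (∑ m, ∑ s, chernRund L m m s x v * chernRund L s a b x v)
    - ∑ m, ∑ s, chernRund L m b s x v * chernRund L s a m x v

/-- A symmetric matrix has Lorentzian signature `(+,-,…,-)`. -/
def IsLorentzian {n : ℕ} (g : Matrix (Fin n) (Fin n) ℝ) : Prop :=
  ∃ P : Matrix (Fin n) (Fin n) ℝ, IsUnit P.det ∧
    P.transpose * g * P = Matrix.diagonal fun i : Fin n => if (i : ℕ) = 0 then 1 else -1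

/-! ### Tensor fields on a manifold and their coordinate components -/

section Manifold

variable {n : ℕ} {M : Type*} [TopologicalSpace M] [ChartedSpace (E n) M]

/-- The tangent vector `vᵃ ∂ₐ` with components `v` at the point with coordinates `x`
in the chart `e`. -/
def tvec (e : OpenPartialHomeomorph M (E n)) (x v : E n) : TangentSpace (𝓡 n) (e.symm x) :=
  mfderiv (𝓡 n) (𝓡 n) e.symm x v

/-- The point of the tangent bundle with manifold induced coordinates `(x, v)`. -/
def tpoint (e : OpenPartialHomeomorph M (E n)) (x v : E n) : TangentBundle (𝓡 n) M :=
  ⟨e.symm x, tvec e x v⟩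

/-- `(x, v)` are the coordinates, in the chart `e`, of a point of `Q ⊆ TM`. -/
def InChart (e : OpenPartialHomeomorph M (E n)) (Q : Set (TangentBundle (𝓡 n) M)) (x v : E n) :
    Prop :=
  x ∈ e.target ∧ tpoint e x v ∈ Q

variable (n M) in
/-- The smooth charts of the manifold `M`. -/
def charts : Set (OpenPartialHomeomorph M (E n)) := IsManifold.maximalAtlas (𝓡 n) ∞ M

/-- A function on the tangent bundle in the coordinates induced by `e`. -/
def loc (e : OpenPartialHomeomorph M (E n)) (L : TangentBundle (𝓡 n) M → ℝ) (x v : E n) : ℝ :=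
  L (tpoint e x v)

variable (n M) in
/-- A smooth pseudo-Riemannian metric, of any signature. -/
structure PseudoRiemannianMetric [IsManifold (𝓡 n) ∞ M] where
  val : ∀ x : M, TangentSpace (𝓡 n) x →L[ℝ] TangentSpace (𝓡 n) x →L[ℝ] ℝ
  symm : ∀ (x : M) (u w : TangentSpace (𝓡 n) x), val x u w = val x w u
  nondegenerate : ∀ (x : M) (u : TangentSpace (𝓡 n) x), (∀ w, val x u w = 0) → u = 0
  smooth : ContMDiff (𝓡 n) ((𝓡 n).prod 𝓘(ℝ, E n →L[ℝ] E n →L[ℝ] ℝ)) ∞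
    (fun x => TotalSpace.mk' (E n →L[ℝ] E n →L[ℝ] ℝ)
      (E := fun x : M => TangentSpace (𝓡 n) x →L[ℝ] TangentSpace (𝓡 n) x →L[ℝ] ℝ) x (val x))

variable (n M) in
/-- A smooth one-form. -/
structure OneForm [IsManifold (𝓡 n) ∞ M] where
  val : ∀ x : M, TangentSpace (𝓡 n) x →L[ℝ] ℝ
  smooth : ContMDiff (𝓡 n) ((𝓡 n).prod 𝓘(ℝ, E n →L[ℝ] ℝ)) ∞
    (fun x => TotalSpace.mk' (E n →L[ℝ] ℝ)
      (E := fun x : M => TangentSpace (𝓡 n) x →L[ℝ] Trivial M ℝ x) x (val x))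

variable [IsManifold (𝓡 n) ∞ M]

/-- The components `α_{ab}(x)` in the chart `e`. -/
def PseudoRiemannianMetric.comp (α : PseudoRiemannianMetric n M)
    (e : OpenPartialHomeomorph M (E n)) (x : E n) : Matrix (Fin n) (Fin n) ℝ :=
  Matrix.of fun a b => α.val (e.symm x) (tvec e x (stdVec a)) (tvec e x (stdVec b))

/-- The components `βₐ(x)` in the chart `e`. -/
def OneForm.comp (β : OneForm n M) (e : OpenPartialHomeomorph M (E n)) (a : Fin n) (x : E n) : ℝ :=
  β.val (e.symm x) (tvec e x (stdVec a))

/-- The Christoffel symbols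
`γᵃ_{bc} = ½ α^{aq} (∂_b α_{cq} + ∂_c α_{bq} - ∂_q α_{bc})` in the chart `e`. -/
def PseudoRiemannianMetric.christoffel (α : PseudoRiemannianMetric n M)
    (e : OpenPartialHomeomorph M (E n)) (a b c : Fin n) (x : E n) : ℝ :=
  (1 / 2) * ∑ q, (α.comp e x)⁻¹ a q *
    (pd b (fun y => α.comp e y c q) x + pd c (fun y => α.comp e y b q) x
      - pd q (fun y => α.comp e y b c) x)

/-- The scalar `α⁻¹(β,β) = α^{ab} βₐ β_b` at the point with coordinates `x` in the chart `e`. -/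
def normSq (α : PseudoRiemannianMetric n M) (β : OneForm n M)
    (e : OpenPartialHomeomorph M (E n)) (x : E n) : ℝ :=
  ∑ a, ∑ b, (α.comp e x)⁻¹ a b * β.comp e a x * β.comp e b x

/-- `∇ₐ β_b = ∂ₐ β_b - γᶜ_{ab} β_c`, with the Levi-Civita connection of `α`. -/
def covDeriv (α : PseudoRiemannianMetric n M) (β : OneForm n M)
    (e : OpenPartialHomeomorph M (E n)) (a b : Fin n) (x : E n) : ℝ :=
  pd a (β.comp e b) x - ∑ c, α.christoffel e c a b x * β.comp e c x

/-- The component `(β ∧ dH)_{ab} = βₐ ∂_b H - β_b ∂ₐ H`. -/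
def wedgeD (β : OneForm n M) (H : M → ℝ) (e : OpenPartialHomeomorph M (E n)) (a b : Fin n)
    (x : E n) : ℝ :=
  β.comp e a x * pd b (fun y => H (e.symm y)) x - β.comp e b x * pd a (fun y => H (e.symm y)) x

/-- The condition
`∇ₐ β_b = H ([c(1-p) + m α⁻¹(β,β)] βₐ β_b + c p α⁻¹(β,β) α_{ab})`. -/
def BerwaldCondition (α : PseudoRiemannianMetric n M) (β : OneForm n M) (c m p : ℝ) (H : M → ℝ) :
    Prop :=
  ∀ e ∈ charts n M, ∀ x ∈ e.target, ∀ a b : Fin n,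
    covDeriv α β e a b x = H (e.symm x) *
      ((c * (1 - p) + m * normSq α β e x) * β.comp e a x * β.comp e b x
        + c * p * normSq α β e x * α.comp e x a b)

/-! ### Finsler spacetimes -/

/-- A conic subbundle of `TM`: a nonempty open subset of `TM \ {0}` that projects onto `M` and is
stable under positive rescaling. -/
structure IsConicSubbundle (Q : Set (TangentBundle (𝓡 n) M)) : Prop where
  nonempty : Q.Nonempty
  isOpen : IsOpen Q
  ne_zero : ∀ v ∈ Q, v.2 ≠ 0
  proj_surjective : ∀ x : M, ∃ v ∈ Q, v.1 = x
  conic : ∀ v ∈ Q, ∀ r : ℝ, 0 < r → (⟨v.1, r • v.2⟩ : TangentBundle (𝓡 n) M) ∈ Q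

variable (n M) in
/-- A Finsler spacetime `(M, L)` with set of admissible vectors `A`. The values of `L` outside `A`
carry no information. -/
structure FinslerSpacetime where
  A : Set (TangentBundle (𝓡 n) M)
  L : TangentBundle (𝓡 n) M → ℝ
  conic : IsConicSubbundle A
  smooth : ContMDiffOn (𝓡 n).tangent 𝓘(ℝ) ∞ L A
  homogeneous : ∀ v ∈ A, ∀ r : ℝ, 0 < r → L ⟨v.1, r • v.2⟩ = r ^ 2 * L v
  nondegenerate : ∀ e ∈ charts n M, ∀ x v, InChart e A x v → (lMetric (loc e L) x v).det ≠ 0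
  exists_timelike : ∃ T : Set (TangentBundle (𝓡 n) M), T ⊆ A ∧ IsConicSubbundle T ∧
    (∀ v ∈ T, 0 < L v) ∧
    (∀ e ∈ charts n M, ∀ x v, InChart e T x v → IsLorentzian (lMetric (loc e L) x v)) ∧
    (∀ v ∈ frontier T, Tendsto L (𝓝[T] v) (𝓝 0))

/-- `(M, L)` is of Berwald type: in every chart the geodesic spray is quadratic in `ẋ`. -/
def FinslerSpacetime.IsBerwald (S : FinslerSpacetime n M) : Prop :=
  ∀ e ∈ charts n M, ∃ G : Fin n → Fin n → Fin n → E n → ℝ, ∀ x v, InChart e S.A x v →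
    ∀ a, spray (loc e S.L) a x v = (1 / 2) * ∑ b, ∑ c, G a b c x * v b * v c

/-- `(M, L)` is metrizable: the Chern–Rund connection is the Levi-Civita connection of some
pseudo-Riemannian metric on `M`. -/
def FinslerSpacetime.IsMetrizable (S : FinslerSpacetime n M) : Prop :=
  ∃ g : PseudoRiemannianMetric n M, ∀ e ∈ charts n M, ∀ x v, InChart e S.A x v →
    ∀ a b c, chernRund (loc e S.L) a b c x v = g.christoffel e a b c x

/-! ### The generalized Bogoslovsky/Kropina Lagrangian -/

/-- The real power `x ^ y` is defined in the elementary sense. -/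
def PowDefined (x y : ℝ) : Prop :=
  0 < x ∨ (x = 0 ∧ 0 ≤ y) ∨ (x < 0 ∧ ∃ k : ℤ, y = k)

/-- `l` is the value `α s^{-p} (c + m s)^{p+1}`, `s = β²/α`, for the numbers `α = α(ẋ,ẋ)` and
`β = β(ẋ)`. The second alternative is the same expression after cancelling `α`, that is
`ζ^{p+1} / β^{2p}` with `ζ = c α + m β²`; it agrees with the first one where both are defined and
covers vectors with `α(ẋ,ẋ) = 0`, or with negative `s` and `c + m s`. -/
def IsBogoslovskyKropinaValue (c m p α β l : ℝ) : Prop :=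
  (α ≠ 0 ∧ PowDefined (β ^ 2 / α) (-p) ∧ PowDefined (c + m * (β ^ 2 / α)) (p + 1) ∧
    l = α * (β ^ 2 / α) ^ (-p) * (c + m * (β ^ 2 / α)) ^ (p + 1)) ∨
  (PowDefined (β ^ 2) (-p) ∧ PowDefined (c * α + m * β ^ 2) (p + 1) ∧
    l = (c * α + m * β ^ 2) ^ (p + 1) * (β ^ 2) ^ (-p))

/-- `L(x,ẋ) = α(ẋ,ẋ) s^{-p} (c + m s)^{p+1}` with `s = β(ẋ)²/α(ẋ,ẋ)`, on all admissible vectors. -/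
def FinslerSpacetime.IsBogoslovskyKropina (S : FinslerSpacetime n M)
    (α : PseudoRiemannianMetric n M) (β : OneForm n M) (c m p : ℝ) : Prop :=
  ∀ v ∈ S.A, IsBogoslovskyKropinaValue c m p (α.val v.1 v.2 v.2) (β.val v.1 v.2) (S.L v)

/-- `f = ½ (4 c p - m α⁻¹(β,β))` at the point with coordinates `x` in the chart `e`. -/
def skewFactor (α : PseudoRiemannianMetric n M) (β : OneForm n M) (c m p : ℝ)
    (e : OpenPartialHomeomorph M (E n)) (x : E n) : ℝ :=
  (1 / 2) * (4 * c * p - m * normSq α β e x)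

end Manifold

end BerwaldSpacetime

end

/-! The proof exhibits an explicit torsion-free affine connection `affCoeff` on `M`, namely the
Levi-Civita connection of `α` plus `H` times a tensor built from `α` and `β`, whose parallel
transport preserves `L`.

Write `ζ = c α(ẋ,ẋ) + m β(ẋ)²`, so that `L = ζ^(p+1) (β(ẋ)²)^(-p)`. By the Berwald condition, the
horizontal derivatives of `β(ẋ)` and `ζ` along this connection are multiples of themselves: `H c
(1+p) β_q β(ẋ)` and `2 H c p β_q ζ`. The logarithmic derivative of `L` is therefore `(p+1)·2cp H β_q
- 2p·c(1+p) H β_q = 0` (`IsBerwaldOn.isParallel`).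

A Lagrangian invariant under a torsion-free affine connection has that connection's quadratic spray
(`IsParallel.spray_eq`) and has it as Chern–Rund connection (`IsParallel.chernRund_eq`). This gives
the Berwald property. The skew part of the Ricci tensor then reduces to the curl of the trace
`Γᵐ_{am}` (`IsParallel.chernRundRicci_sub`).

The Levi-Civita part of the trace is closed, being locally `½ d log |det α|`
(`IsMetricOn.pd_trace_chris_comm`). The rest is `H (m |β|² - n c p) β`. Here `dβ = 0` and `d|β|²` is
a multiple of `β`, so only the term with `dH` survives in the curl
(`IsBerwaldOn.pd_trace_affCoeff_sub`). Metrizability would make the whole trace closed, which is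
impossible where `f β ∧ dH ≠ 0`. -/

namespace BerwaldSpacetime

/-! ### Smoothness and components of tensor fields in charts. -/

section Charts

variable {n : ℕ} {M : Type*} [TopologicalSpace M] [ChartedSpace (E n) M] [IsManifold (𝓡 n) ∞ M]
  {e : OpenPartialHomeomorph M (E n)}

/-- The tangent bundle of a vector space is trivialized by the identity. Composing with the tangent
map of `e.symm` then gives smoothness of `tpoint`. -/
theorem contMDiff_mk_tangentBundle :
    ContMDiff 𝓘(ℝ, E n × E n) (𝓡 n).tangent ∞
      (fun z : E n × E n => (⟨z.1, z.2⟩ : TangentBundle (𝓡 n) (E n))) := by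
  intro z
  rw [contMDiffAt_totalSpace]
  refine ⟨contDiff_fst.contMDiff.contMDiffAt, ?_⟩
  refine (contDiff_snd.contMDiff.contMDiffAt (x := z)).congr_of_eventuallyEq ?_
  filter_upwards with y
  simp

theorem contMDiffOn_tpoint (he : e ∈ charts n M) :
    ContMDiffOn 𝓘(ℝ, E n × E n) (𝓡 n).tangent ∞
      (fun z : E n × E n => tpoint e z.1 z.2) (e.target ×ˢ univ) := by
  have h1 := contMDiffOn_symm_of_mem_maximalAtlas he
  have : IsManifold (𝓡 n) 1 M := IsManifold.of_le (m := 1) (n := ∞) (by norm_cast)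
  have h2 := h1.contMDiffOn_tangentMapWithin (m := ∞) (by simp) e.open_target.uniqueMDiffOn
  refine (h2.comp contMDiff_mk_tangentBundle.contMDiffOn
    (s := e.target ×ˢ univ) (fun z hz => hz.1)).congr ?_
  rintro ⟨x, v⟩ ⟨hx, -⟩
  simp only [tpoint, tvec, tangentMapWithin, Function.comp]
  rw [mfderivWithin_of_isOpen e.open_target hx]

theorem isOpen_inChart (he : e ∈ charts n M) {A : Set (TangentBundle (𝓡 n) M)} (hA : IsOpen A) :
    IsOpen {z : E n × E n | InChart e A z.1 z.2} := by
  have := (contMDiffOn_tpoint he).continuousOn.isOpen_inter_preimage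
    (e.open_target.prod isOpen_univ) hA
  convert this using 1
  ext z
  simp [InChart]

theorem contDiffOn_loc (he : e ∈ charts n M) {A : Set (TangentBundle (𝓡 n) M)}
    {L : TangentBundle (𝓡 n) M → ℝ} (hL : ContMDiffOn (𝓡 n).tangent 𝓘(ℝ) ∞ L A) :
    ContDiffOn ℝ ∞ (fun z : E n × E n => loc e L z.1 z.2)
      {z : E n × E n | InChart e A z.1 z.2} := by
  rw [← contMDiffOn_iff_contDiffOn]
  exact hL.comp ((contMDiffOn_tpoint he).mono fun z hz => ⟨hz.1, mem_univ _⟩) fun z hz => hz.2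

theorem contMDiffOn_tvec (he : e ∈ charts n M) (v : E n) :
    ContMDiffOn 𝓘(ℝ, E n) (𝓡 n).tangent ∞
      (fun x => (TotalSpace.mk' (E n) (e.symm x) (tvec e x v) : TangentBundle (𝓡 n) M))
        e.target := by
  refine (contMDiffOn_tpoint he).comp (t := e.target ×ˢ univ) (f := fun x => (x, v)) ?_
    fun x hx => ⟨hx, mem_univ _⟩
  exact (contDiff_id.prodMk contDiff_const).contMDiff.contMDiffOn

theorem PseudoRiemannianMetric.contDiffOn_comp (α : PseudoRiemannianMetric n M)
    (he : e ∈ charts n M) (a b : Fin n) :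
    ContDiffOn ℝ ∞ (fun x => α.comp e x a b) e.target := by
  rw [← contMDiffOn_iff_contDiffOn]
  intro x hx
  have h := ContMDiffWithinAt.clm_bundle_apply₂ (n := ∞) (F₁ := E n) (F₂ := E n) (F₃ := ℝ)
    (E₁ := fun x : M => TangentSpace (𝓡 n) x) (E₂ := fun x : M => TangentSpace (𝓡 n) x)
    (E₃ := Trivial M ℝ) (IB := 𝓡 n) (IM := 𝓘(ℝ, E n)) (b := e.symm)
    (ψ := fun x => α.val (e.symm x)) (s := e.target) (x := x)
    ((α.smooth.contMDiffAt).comp_contMDiffWithinAt x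
      (contMDiffOn_symm_of_mem_maximalAtlas he x hx))
    (contMDiffOn_tvec he (stdVec a) x hx) (contMDiffOn_tvec he (stdVec b) x hx)
  rw [contMDiffWithinAt_totalSpace] at h
  exact h.2

theorem OneForm.contDiffOn_comp (β : OneForm n M) (he : e ∈ charts n M) (a : Fin n) :
    ContDiffOn ℝ ∞ (β.comp e a) e.target := by
  rw [← contMDiffOn_iff_contDiffOn]
  intro x hx
  have h := ContMDiffWithinAt.clm_bundle_apply (n := ∞) (F₁ := E n) (F₂ := ℝ)
    (E₁ := fun x : M => TangentSpace (𝓡 n) x)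
    (E₂ := Trivial M ℝ) (IB := 𝓡 n) (IM := 𝓘(ℝ, E n)) (b := e.symm)
    (ϕ := fun x => β.val (e.symm x)) (s := e.target) (x := x)
    ((β.smooth.contMDiffAt).comp_contMDiffWithinAt x
      (contMDiffOn_symm_of_mem_maximalAtlas he x hx))
    (contMDiffOn_tvec he (stdVec a) x hx)
  rw [contMDiffWithinAt_totalSpace] at h
  exact h.2

omit [IsManifold (𝓡 n) ∞ M] in
theorem contDiffOn_comp_symm {H : M → ℝ} (hH : ContMDiff (𝓡 n) 𝓘(ℝ) ∞ H) (he : e ∈ charts n M) :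
    ContDiffOn ℝ ∞ (fun y => H (e.symm y)) e.target := by
  rw [← contMDiffOn_iff_contDiffOn]
  exact hH.comp_contMDiffOn (contMDiffOn_symm_of_mem_maximalAtlas he)

omit [IsManifold (𝓡 n) ∞ M] in
theorem mdifferentiable_of_mem_charts (he : e ∈ charts n M) : e.MDifferentiable (𝓡 n) (𝓡 n) :=
  ⟨(contMDiffOn_of_mem_maximalAtlas he).mdifferentiableOn (by simp),
    (contMDiffOn_symm_of_mem_maximalAtlas he).mdifferentiableOn (by simp)⟩

omit [IsManifold (𝓡 n) ∞ M] in
theorem tvec_bijective (he : e ∈ charts n M) {x : E n} (hx : x ∈ e.target) :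
    Function.Bijective (tvec e x) :=
  (mdifferentiable_of_mem_charts he).symm.mfderiv_bijective (e := e.symm) hx

theorem eq_sum_stdVec (v : E n) : v = ∑ a, v a • stdVec a := by
  ext i
  simp [stdVec, Finset.sum_apply, Pi.single_apply]

omit [IsManifold (𝓡 n) ∞ M] in
theorem tvec_eq_sum (x v : E n) : tvec e x v = ∑ a, v a • tvec e x (stdVec a) := by
  let f : E n →ₗ[ℝ] TangentSpace (𝓡 n) (e.symm x) := (mfderiv (𝓡 n) (𝓡 n) e.symm x).toLinearMap
  have h := congrArg f (eq_sum_stdVec v)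
  rw [map_sum] at h
  simp_rw [map_smul] at h
  exact h

omit [IsManifold (𝓡 n) ∞ M] in
theorem tvec_zero (x : E n) : tvec e x 0 = 0 :=
  (mfderiv (𝓡 n) (𝓡 n) e.symm x).toLinearMap.map_zero

theorem PseudoRiemannianMetric.val_tvec (α : PseudoRiemannianMetric n M) (x v w : E n) :
    α.val (e.symm x) (tvec e x v) (tvec e x w) = ∑ a, ∑ b, α.comp e x a b * v a * w b := by
  rw [tvec_eq_sum x v, tvec_eq_sum x w]
  simp only [map_sum, map_smul, sum_apply, smul_apply,
    smul_eq_mul, comp, Matrix.of_apply]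
  rw [Finset.sum_comm]
  simp only [Finset.mul_sum]
  refine Finset.sum_congr rfl fun a _ => Finset.sum_congr rfl fun b _ => ?_
  ring

theorem OneForm.val_tvec (β : OneForm n M) (x v : E n) :
    β.val (e.symm x) (tvec e x v) = ∑ a, β.comp e a x * v a := by
  rw [tvec_eq_sum x v]
  simp only [map_sum, map_smul, smul_eq_mul, comp, mul_comm]

theorem PseudoRiemannianMetric.comp_symm (α : PseudoRiemannianMetric n M) (x : E n)
    (a b : Fin n) : α.comp e x a b = α.comp e x b a :=
  α.symm _ _ _

/-- A kernel vector of the component matrix would be the coordinates of a tangent vector orthogonal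
to all others, because `tvec e x` is a bijection. -/
theorem PseudoRiemannianMetric.det_comp_ne_zero (α : PseudoRiemannianMetric n M)
    (he : e ∈ charts n M) {x : E n} (hx : x ∈ e.target) : (α.comp e x).det ≠ 0 := by
  intro h0
  obtain ⟨w, hw, h⟩ := Matrix.exists_vecMul_eq_zero_iff.2 h0
  set v : E n := WithLp.toLp 2 w with hv
  have hz : tvec e x v = 0 := by
    refine α.nondegenerate _ _ fun u => ?_
    obtain ⟨u, rfl⟩ := (tvec_bijective he hx).2 u
    rw [α.val_tvec, Finset.sum_comm]
    refine Finset.sum_eq_zero fun b _ => ?_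
    rw [← Finset.sum_mul]
    have := congrFun h b
    simp only [Matrix.vecMul, dotProduct, Pi.zero_apply] at this
    simp only [hv]
    simp_rw [mul_comm (α.comp e x _ b), this, zero_mul]
  have : v = 0 := (tvec_bijective he hx).1 (hz.trans (tvec_zero x).symm)
  exact hw (by simpa [hv] using this)

theorem IsConicSubbundle.exists_inChart {A : Set (TangentBundle (𝓡 n) M)}
    (hA : IsConicSubbundle A) (he : e ∈ charts n M) {x : E n} (hx : x ∈ e.target) :
    ∃ v, InChart e A x v := by
  obtain ⟨⟨y, w⟩, hv, rfl⟩ := hA.proj_surjective (e.symm x)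
  obtain ⟨v, rfl⟩ := (tvec_bijective he hx).2 w
  exact ⟨v, hx, hv⟩

end Charts


/-! ### Calculus of partial derivatives on `ℝⁿ`. -/

section PartialDerivatives

variable {n : ℕ} {a : Fin n} {y : E n}

theorem pd_congr {F F' : E n → ℝ} (h : F =ᶠ[𝓝 y] F') : pd a F y = pd a F' y := by
  unfold pd
  rw [h.fderiv_eq]

theorem pd_const (k : ℝ) : pd a (fun _ => k) y = 0 := by
  simp [pd]

theorem pd_add {F F' : E n → ℝ} (h : DifferentiableAt ℝ F y) (h' : DifferentiableAt ℝ F' y) :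
    pd a (fun y => F y + F' y) y = pd a F y + pd a F' y := by
  unfold pd
  rw [fderiv_fun_add h h', add_apply]

theorem pd_mul {F F' : E n → ℝ} (h : DifferentiableAt ℝ F y) (h' : DifferentiableAt ℝ F' y) :
    pd a (fun y => F y * F' y) y = pd a F y * F' y + F y * pd a F' y := by
  unfold pd
  rw [fderiv_fun_mul h h']
  simp only [add_apply, smul_apply, smul_eq_mul]
  ring

theorem pd_const_mul {F : E n → ℝ} (k : ℝ) (h : DifferentiableAt ℝ F y) :
    pd a (fun y => k * F y) y = k * pd a F y := by
  rw [pd_mul (differentiableAt_const k) h, pd_const, zero_mul, zero_add]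

theorem pd_sum {ι : Type*} {s : Finset ι} {F : ι → E n → ℝ}
    (h : ∀ i ∈ s, DifferentiableAt ℝ (F i) y) :
    pd a (fun y => ∑ i ∈ s, F i y) y = ∑ i ∈ s, pd a (F i) y := by
  unfold pd
  rw [fderiv_fun_sum h, sum_apply]

theorem differentiableAt_coord (i : Fin n) : DifferentiableAt ℝ (fun v : E n => v i) y := by
  fun_prop

theorem pd_coord (i : Fin n) : pd a (fun v : E n => v i) y = if i = a then 1 else 0 := by
  have h : HasFDerivAt (fun v : E n => v i) (EuclideanSpace.proj i : E n →L[ℝ] ℝ) y :=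
    (EuclideanSpace.proj i : E n →L[ℝ] ℝ).hasFDerivAt
  unfold pd
  rw [h.fderiv]
  simp [stdVec]

theorem pd_pd_comm {F : E n → ℝ} (h : ContDiffAt ℝ ∞ F y) (a b : Fin n) :
    pd a (pd b F) y = pd b (pd a F) y := by
  have hd : DifferentiableAt ℝ (fderiv ℝ F) y :=
    (h.fderiv_right (m := 1) (by norm_cast)).differentiableAt one_ne_zero
  have hs : IsSymmSndFDerivAt ℝ F y := h.isSymmSndFDerivAt (by simp; norm_cast)
  have key : ∀ a b : Fin n, pd a (pd b F) y = fderiv ℝ (fderiv ℝ F) y (stdVec a) (stdVec b) := by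
    intro a b
    change fderiv ℝ (fun z => fderiv ℝ F z (stdVec b)) y (stdVec a) = _
    rw [fderiv_clm_apply hd (differentiableAt_const _)]
    simp
  rw [key, key, hs.eq]

theorem contDiffOn_pd {W : Set (E n)} (hW : IsOpen W) {F : E n → ℝ} (hF : ContDiffOn ℝ ∞ F W)
    (a : Fin n) : ContDiffOn ℝ ∞ (pd a F) W :=
  (hF.fderiv_of_isOpen hW (by norm_cast)).clm_apply contDiffOn_const

end PartialDerivatives

/-! ### Calculus on phase space: base and fibre derivatives on an open set. -/

section PhaseSpace

variable {n : ℕ} {U : Set (E n × E n)} {F F' : E n → E n → ℝ} {x v : E n}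

/-- The uncurried form of a function of position and velocity. -/
abbrev unc (F : E n → E n → ℝ) (z : E n × E n) : ℝ := F z.1 z.2

theorem dx_eq_fderiv (h : DifferentiableAt ℝ (unc F) (x, v)) (a : Fin n) :
    dx a F x v = fderiv ℝ (unc F) (x, v) (stdVec a, 0) := by
  have := (HasFDerivAt.comp (f := fun e => (e, v)) x h.hasFDerivAt
    (hasFDerivAt_prodMk_left x v)).fderiv
  change fderiv ℝ (unc F ∘ fun e => (e, v)) x (stdVec a) = _
  rw [this]
  simp

theorem dv_eq_fderiv (h : DifferentiableAt ℝ (unc F) (x, v)) (a : Fin n) :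
    dv a F x v = fderiv ℝ (unc F) (x, v) (0, stdVec a) := by
  have := (HasFDerivAt.comp (f := fun e => (x, e)) v h.hasFDerivAt
    (hasFDerivAt_prodMk_right x v)).fderiv
  change fderiv ℝ (unc F ∘ fun e => (x, e)) v (stdVec a) = _
  rw [this]
  simp

theorem contDiffAt_of_mem (hU : IsOpen U) (hF : ContDiffOn ℝ ∞ (unc F) U) (hz : (x, v) ∈ U) :
    ContDiffAt ℝ ∞ (unc F) (x, v) :=
  hF.contDiffAt (hU.mem_nhds hz)

theorem differentiableAt_of_mem (hU : IsOpen U) (hF : ContDiffOn ℝ ∞ (unc F) U)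
    (hz : (x, v) ∈ U) : DifferentiableAt ℝ (unc F) (x, v) :=
  (contDiffAt_of_mem hU hF hz).differentiableAt (by simp)

theorem differentiableAt_fiber (hU : IsOpen U) (hF : ContDiffOn ℝ ∞ (unc F) U)
    (hz : (x, v) ∈ U) : DifferentiableAt ℝ (F x) v :=
  (HasFDerivAt.comp (f := fun e => (x, e)) v (differentiableAt_of_mem hU hF hz).hasFDerivAt
    (hasFDerivAt_prodMk_right x v)).differentiableAt

theorem differentiableAt_base (hU : IsOpen U) (hF : ContDiffOn ℝ ∞ (unc F) U)
    (hz : (x, v) ∈ U) : DifferentiableAt ℝ (fun y => F y v) x :=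
  (HasFDerivAt.comp (f := fun e => (e, v)) x (differentiableAt_of_mem hU hF hz).hasFDerivAt
    (hasFDerivAt_prodMk_left x v)).differentiableAt

theorem eventually_fiber (hU : IsOpen U) (hz : (x, v) ∈ U) : ∀ᶠ w in 𝓝 v, (x, w) ∈ U :=
  (Continuous.prodMk_right x).continuousAt.preimage_mem_nhds (hU.mem_nhds hz)

theorem eventually_base (hU : IsOpen U) (hz : (x, v) ∈ U) : ∀ᶠ y in 𝓝 x, (y, v) ∈ U :=
  (Continuous.prodMk_left v).continuousAt.preimage_mem_nhds (hU.mem_nhds hz)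

theorem contDiffOn_dx (hU : IsOpen U) (hF : ContDiffOn ℝ ∞ (unc F) U) (a : Fin n) :
    ContDiffOn ℝ ∞ (unc (dx a F)) U :=
  ((hF.fderiv_of_isOpen hU (by norm_cast)).clm_apply contDiffOn_const).congr
    fun _ hz => dx_eq_fderiv (differentiableAt_of_mem hU hF hz) a

theorem contDiffOn_dv (hU : IsOpen U) (hF : ContDiffOn ℝ ∞ (unc F) U) (a : Fin n) :
    ContDiffOn ℝ ∞ (unc (dv a F)) U :=
  ((hF.fderiv_of_isOpen hU (by norm_cast)).clm_apply contDiffOn_const).congr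
    fun _ hz => dv_eq_fderiv (differentiableAt_of_mem hU hF hz) a

theorem dx_congr (hU : IsOpen U) (h : ∀ x v, (x, v) ∈ U → F x v = F' x v) (hz : (x, v) ∈ U)
    (a : Fin n) : dx a F x v = dx a F' x v :=
  pd_congr ((eventually_base hU hz).mono fun _ hy => h _ _ hy)

theorem dv_congr (hU : IsOpen U) (h : ∀ x v, (x, v) ∈ U → F x v = F' x v) (hz : (x, v) ∈ U)
    (a : Fin n) : dv a F x v = dv a F' x v :=
  pd_congr ((eventually_fiber hU hz).mono fun _ hy => h _ _ hy)

theorem fderiv_fderiv_comm {f : E n × E n → ℝ} {z : E n × E n} (h : ContDiffAt ℝ ∞ f z)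
    (u w : E n × E n) :
    fderiv ℝ (fun y => fderiv ℝ f y u) z w = fderiv ℝ (fun y => fderiv ℝ f y w) z u := by
  have hd : DifferentiableAt ℝ (fderiv ℝ f) z :=
    (h.fderiv_right (m := 1) (by norm_cast)).differentiableAt one_ne_zero
  have hs : IsSymmSndFDerivAt ℝ f z := h.isSymmSndFDerivAt (by simp; norm_cast)
  rw [fderiv_clm_apply hd (differentiableAt_const _), fderiv_clm_apply hd (differentiableAt_const _)]
  simp [hs.eq]

theorem dx_dv_comm (hU : IsOpen U) (hF : ContDiffOn ℝ ∞ (unc F) U) (hz : (x, v) ∈ U)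
    (a b : Fin n) : dx a (dv b F) x v = dv b (dx a F) x v := by
  rw [dx_eq_fderiv (differentiableAt_of_mem hU (contDiffOn_dv hU hF b) hz),
    dv_eq_fderiv (differentiableAt_of_mem hU (contDiffOn_dx hU hF a) hz)]
  have h1 : unc (dv b F) =ᶠ[𝓝 (x, v)] fun y => fderiv ℝ (unc F) y (0, stdVec b) := by
    filter_upwards [hU.mem_nhds hz] with y hy
    exact dv_eq_fderiv (differentiableAt_of_mem hU hF hy) b
  have h2 : unc (dx a F) =ᶠ[𝓝 (x, v)] fun y => fderiv ℝ (unc F) y (stdVec a, 0) := by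
    filter_upwards [hU.mem_nhds hz] with y hy
    exact dx_eq_fderiv (differentiableAt_of_mem hU hF hy) a
  rw [h1.fderiv_eq, h2.fderiv_eq]
  exact fderiv_fderiv_comm (contDiffAt_of_mem hU hF hz) _ _

theorem dv_dv_comm (hU : IsOpen U) (hF : ContDiffOn ℝ ∞ (unc F) U) (hz : (x, v) ∈ U)
    (a b : Fin n) : dv a (dv b F) x v = dv b (dv a F) x v :=
  pd_pd_comm ((contDiffAt_of_mem hU hF hz).comp v (contDiff_prodMk_right x).contDiffAt) a b

end PhaseSpace

/-! ### Finsler geometry of a Lagrangian preserved by an affine connection. -/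

section ParallelLagrangian

variable {n : ℕ} {U : Set (E n × E n)} {L : E n → E n → ℝ}
  {G : Fin n → Fin n → Fin n → E n → ℝ} {x v : E n}

/-- The components `Gᵇ_{qc} ẋᶜ` of the nonlinear connection of an affine connection. -/
def nonlin (G : Fin n → Fin n → Fin n → E n → ℝ) (b q : Fin n) (x v : E n) : ℝ :=
  ∑ c, G b q c x * v c

/-- The Lagrangian `L` is invariant on `U` under the parallel transport of the affine
connection with coefficients `G`. -/
def IsParallel (G : Fin n → Fin n → Fin n → E n → ℝ) (L : E n → E n → ℝ)
    (U : Set (E n × E n)) : Prop :=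
  ∀ x v, (x, v) ∈ U → ∀ q, dx q L x v = ∑ b, nonlin G b q x v * dv b L x v

theorem differentiableAt_nonlin (b q : Fin n) : DifferentiableAt ℝ (nonlin G b q x) v := by
  unfold nonlin
  fun_prop

theorem pd_nonlin (b q r : Fin n) : pd r (nonlin G b q x) v = G b q r x := by
  change pd r (fun v : E n => ∑ c, G b q c x * v c) v = _
  rw [pd_sum fun c _ => (differentiableAt_coord c).const_mul _]
  simp_rw [pd_const_mul _ (differentiableAt_coord _), pd_coord]
  simp

variable (hU : IsOpen U) (hL : ContDiffOn ℝ ∞ (unc L) U) (hpar : IsParallel G L U)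
include hU hL hpar

theorem IsParallel.dv_dx (hz : (x, v) ∈ U) (q r : Fin n) :
    dv r (dx q L) x v =
      ∑ b, (G b q r x * dv b L x v + nonlin G b q x v * dv r (dv b L) x v) := by
  rw [dv_congr hU (F' := fun x v => ∑ b, nonlin G b q x v * dv b L x v)
    (fun x v h => hpar x v h q) hz]
  have hd := fun b => differentiableAt_fiber hU (contDiffOn_dv hU hL b) hz
  change pd r (fun v => ∑ b, nonlin G b q x v * dv b L x v) v = _
  rw [pd_sum fun b _ => (differentiableAt_nonlin b q).fun_mul (hd b)]
  refine Finset.sum_congr rfl fun b _ => ?_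
  rw [pd_mul (differentiableAt_nonlin b q) (hd b), pd_nonlin]
  rfl

/-- The second fibre derivative of the parallelism identity. Up to the factor ½ it is the
compatibility of `G` with the `L`-metric. -/
theorem IsParallel.dv_dv_dx (hz : (x, v) ∈ U) (q r s : Fin n) :
    dv s (dv r (dx q L)) x v =
      ∑ b, (G b q r x * dv s (dv b L) x v + (G b q s x * dv r (dv b L) x v
        + nonlin G b q x v * dv s (dv r (dv b L)) x v)) := by
  rw [dv_congr hU (F' := fun x v =>
    ∑ b, (G b q r x * dv b L x v + nonlin G b q x v * dv r (dv b L) x v))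
    (fun x v h => hpar.dv_dx hU hL h q r) hz]
  have hd := fun b => differentiableAt_fiber hU (contDiffOn_dv hU hL b) hz
  have hd2 := fun b => differentiableAt_fiber hU (contDiffOn_dv hU (contDiffOn_dv hU hL b) r) hz
  change pd s (fun v => ∑ b, (G b q r x * dv b L x v + nonlin G b q x v * dv r (dv b L) x v)) v = _
  rw [pd_sum fun b _ => ((hd b).const_mul _).fun_add ((differentiableAt_nonlin b q).fun_mul (hd2 b))]
  refine Finset.sum_congr rfl fun b _ => ?_
  rw [pd_add ((hd b).const_mul _) ((differentiableAt_nonlin b q).fun_mul (hd2 b)),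
    pd_mul (differentiableAt_nonlin b q) (hd2 b), pd_const_mul _ (hd b),
    pd_nonlin]
  rfl

variable (hG : ∀ x v, (x, v) ∈ U → ∀ a b c, G a b c x = G a c b x)
  (hdet : ∀ x v, (x, v) ∈ U → (lMetric L x v).det ≠ 0)
include hG hdet

theorem IsParallel.spray_eq (hz : (x, v) ∈ U) (a : Fin n) :
    spray L a x v = (1 / 2) * ∑ b, nonlin G a b x v * v b := by
  have h : ∀ q, (∑ m, v m * dx m (dv q L) x v) - dx q L x v
      = ∑ b, lMetric L x v q b * (2 * ∑ m, nonlin G b m x v * v m) := by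
    intro q
    simp_rw [dx_dv_comm hU hL hz, hpar.dv_dx hU hL hz, Finset.mul_sum, mul_add,
      Finset.sum_add_distrib]
    -- By symmetry of `G`, contracting with `ẋᵐ` turns the first-order terms back into the
    -- parallelism identity, so they cancel `∂_q L`. Only `2 g_{qb} Gᵇ_{mc} ẋᵐ ẋᶜ` remains.
    have : ∑ m, ∑ b, v m * (G b m q x * dv b L x v) = dx q L x v := by
      rw [hpar x v hz, Finset.sum_comm]
      refine Finset.sum_congr rfl fun b _ => ?_
      rw [nonlin, Finset.sum_mul]
      refine Finset.sum_congr rfl fun m _ => ?_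
      rw [hG x v hz b m q]
      ring
    rw [this, add_sub_cancel_left, Finset.sum_comm]
    refine Finset.sum_congr rfl fun b _ => Finset.sum_congr rfl fun m _ => ?_
    simp only [lMetric, Matrix.of_apply]
    ring
  unfold spray
  simp_rw [h]
  change (1 / 4) * ((lMetric L x v)⁻¹.mulVec ((lMetric L x v).mulVec
    fun b => 2 * ∑ m, nonlin G b m x v * v m)) a = _
  rw [Matrix.mulVec_mulVec, Matrix.nonsing_inv_mul _ (hdet x v hz).isUnit, Matrix.one_mulVec]
  ring

theorem IsParallel.dv_spray (hz : (x, v) ∈ U) (a b : Fin n) :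
    dv b (spray L a) x v = nonlin G a b x v := by
  rw [dv_congr hU (F' := fun x v => (1 / 2) * ∑ b, nonlin G a b x v * v b)
    (fun x v h => hpar.spray_eq hU hL hG hdet h a) hz]
  have hm := fun m : Fin n =>
    (differentiableAt_nonlin (G := G) (x := x) (v := v) a m).fun_mul (differentiableAt_coord (y := v) m)
  change pd b (fun v => (1 / 2) * ∑ b, nonlin G a b x v * v b) v = _
  rw [pd_const_mul _ (DifferentiableAt.fun_sum fun m _ => hm m), pd_sum fun m _ => hm m]
  have h : ∀ m, pd b (fun v => nonlin G a m x v * v m) v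
      = G a m b x * v m + nonlin G a m x v * if m = b then 1 else 0 := by
    intro m
    rw [pd_mul (differentiableAt_nonlin a m) (differentiableAt_coord m), pd_coord,
      pd_nonlin]
  simp_rw [h, Finset.sum_add_distrib]
  have : ∑ m, G a m b x * v m = nonlin G a b x v :=
    Finset.sum_congr rfl fun m _ => by rw [hG x v hz a m b]
  rw [this]
  simp
  ring

theorem IsParallel.hor_eq (hz : (x, v) ∈ U) (q : Fin n) (F : E n → E n → ℝ) :
    hor L q F x v = dx q F x v - ∑ b, nonlin G b q x v * dv b F x v := by
  unfold hor
  simp_rw [hpar.dv_spray hU hL hG hdet hz]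

/-- The third fibre derivatives of `L` produced by `∂_q g_{rs}` are exactly those that the
horizontal derivative subtracts. -/
theorem IsParallel.hor_lMetric (hz : (x, v) ∈ U) (q r s : Fin n) :
    hor L q (fun x v => lMetric L x v r s) x v
      = ∑ b, (G b q r x * lMetric L x v s b + G b q s x * lMetric L x v r b) := by
  have hd := differentiableAt_base hU (contDiffOn_dv hU (contDiffOn_dv hU hL s) r) hz
  have h1 : dx q (fun x v => lMetric L x v r s) x v
      = (1 / 2) * dv r (dv s (dx q L)) x v := by
    change pd q (fun y => (1 / 2) * dv r (dv s L) y v) x = _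
    rw [pd_const_mul _ hd]
    change (1 / 2) * dx q (dv r (dv s L)) x v = _
    rw [dx_dv_comm hU (contDiffOn_dv hU hL s) hz,
      dv_congr hU (fun x v h => dx_dv_comm hU hL h q s) hz]
  have h2 : ∀ b, dv b (fun x v => lMetric L x v r s) x v
      = (1 / 2) * dv r (dv s (dv b L)) x v := by
    intro b
    change pd b (fun w => (1 / 2) * dv r (dv s L) x w) v = _
    rw [pd_const_mul _ (differentiableAt_fiber hU (contDiffOn_dv hU (contDiffOn_dv hU hL s) r) hz)]
    change (1 / 2) * dv b (dv r (dv s L)) x v = _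
    rw [dv_dv_comm hU (contDiffOn_dv hU hL s) hz,
      dv_congr hU (fun x v h => dv_dv_comm hU hL h b s) hz]
  rw [hpar.hor_eq hU hL hG hdet hz, h1, hpar.dv_dv_dx hU hL hz, Finset.mul_sum,
    ← Finset.sum_sub_distrib]
  refine Finset.sum_congr rfl fun b _ => ?_
  rw [h2]
  simp only [lMetric, Matrix.of_apply]
  ring

/-- The Koszul argument: a symmetric connection compatible with the nondegenerate `L`-metric is
determined by the horizontal derivatives of that metric. -/
theorem IsParallel.chernRund_eq (hz : (x, v) ∈ U) (a b c : Fin n) :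
    chernRund L a b c x v = G a b c x := by
  have hs : ∀ r s, lMetric L x v r s = lMetric L x v s r := fun r s => by
    simp only [lMetric, Matrix.of_apply]
    rw [dv_dv_comm hU hL hz]
  have h : ∀ q, hor L b (fun x' v' => lMetric L x' v' c q) x v
      + hor L c (fun x' v' => lMetric L x' v' b q) x v
      - hor L q (fun x' v' => lMetric L x' v' b c) x v
      = ∑ d, lMetric L x v q d * (2 * G d b c x) := by
    intro q
    simp_rw [hpar.hor_lMetric hU hL hG hdet hz, ← Finset.sum_add_distrib, ← Finset.sum_sub_distrib]
    refine Finset.sum_congr rfl fun d _ => ?_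
    rw [hG x v hz d c b, hG x v hz d q b, hG x v hz d q c]
    ring
  unfold chernRund
  simp_rw [h]
  change (1 / 2) * ((lMetric L x v)⁻¹.mulVec ((lMetric L x v).mulVec
    fun d => 2 * G d b c x)) a = _
  rw [Matrix.mulVec_mulVec, Matrix.nonsing_inv_mul _ (hdet x v hz).isUnit, Matrix.one_mulVec]
  ring

theorem IsParallel.hor_of_eqOn {F : E n → E n → ℝ} {f : E n → ℝ}
    (hF : ∀ x v, (x, v) ∈ U → F x v = f x) (hz : (x, v) ∈ U) (q : Fin n) :
    hor L q F x v = pd q f x := by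
  rw [hpar.hor_eq hU hL hG hdet hz, dx_congr hU (F' := fun x _ => f x) hF hz]
  have : ∀ b, dv b F x v = 0 := fun b => by
    rw [dv_congr hU (F' := fun x _ => f x) hF hz]
    exact pd_const (f x)
  simp_rw [this]
  simp [dx]

/-- The divergence term and both quadratic terms of the Ricci tensor are symmetric in `a, b`. Only
the derivative of the trace can contribute to the skew part. -/
theorem IsParallel.chernRundRicci_sub (hz : (x, v) ∈ U)
    (hGd : ∀ a b c, DifferentiableAt ℝ (G a b c) x) (a b : Fin n) :
    chernRundRicci L a b x v - chernRundRicci L b a x v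
      = pd a (fun y => ∑ m, G m b m y) x - pd b (fun y => ∑ m, G m a m y) x := by
  have hc := fun i j k => fun x v (h : (x, v) ∈ U) =>
    hpar.chernRund_eq hU hL hG hdet h i j k
  have h1 : ∀ m, hor L m (chernRund L m b a) x v = hor L m (chernRund L m a b) x v := by
    intro m
    rw [hpar.hor_of_eqOn hU hL hG hdet (hc m a b) hz,
      hpar.hor_of_eqOn hU hL hG hdet (f := G m a b) (fun x v h => ?_) hz]
    rw [hc m b a x v h, hG x v h]
  have h2 : ∑ m, ∑ s, chernRund L m a s x v * chernRund L s b m x v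
      = ∑ m, ∑ s, chernRund L m b s x v * chernRund L s a m x v := by
    rw [Finset.sum_comm]
    refine Finset.sum_congr rfl fun m _ => Finset.sum_congr rfl fun s _ => ?_
    ring
  have h3 : ∑ m, ∑ s, chernRund L m m s x v * chernRund L s b a x v
      = ∑ m, ∑ s, chernRund L m m s x v * chernRund L s a b x v := by
    refine Finset.sum_congr rfl fun m _ => Finset.sum_congr rfl fun s _ => ?_
    rw [hc s b a x v hz, hc s a b x v hz, hG x v hz]
  unfold chernRundRicci
  simp_rw [h1]
  rw [h2, h3, pd_sum fun m _ => hGd m b m, pd_sum fun m _ => hGd m a m]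
  simp_rw [hpar.hor_of_eqOn hU hL hG hdet (hc _ _ _) hz]
  ring

end ParallelLagrangian


/-! ### Levi-Civita identities for a metric in coordinates. -/

section LocalMetric

variable {n : ℕ} {W : Set (E n)} {g : E n → Matrix (Fin n) (Fin n) ℝ} {b : Fin n → E n → ℝ}
  {x : E n}

/-- The Christoffel symbols of a field of matrices. -/
noncomputable def chris (g : E n → Matrix (Fin n) (Fin n) ℝ) (i j k : Fin n) (x : E n) : ℝ :=
  (1 / 2) * ∑ q, (g x)⁻¹ i q *
    (pd j (fun y => g y k q) x + pd k (fun y => g y j q) x - pd q (fun y => g y j k) x)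

/-- The components `bⁱ = g^{ij} b_j`. -/
noncomputable def raised (g : E n → Matrix (Fin n) (Fin n) ℝ) (b : Fin n → E n → ℝ) (i : Fin n) (x : E n) : ℝ :=
  ∑ j, (g x)⁻¹ i j * b j x

/-- The square `g^{ij} b_i b_j`. -/
noncomputable def sqNorm (g : E n → Matrix (Fin n) (Fin n) ℝ) (b : Fin n → E n → ℝ) (x : E n) : ℝ :=
  ∑ i, ∑ j, (g x)⁻¹ i j * b i x * b j x

/-- A smooth field of nondegenerate symmetric matrices. -/
structure IsMetricOn (g : E n → Matrix (Fin n) (Fin n) ℝ) (W : Set (E n)) : Prop where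
  isOpen : IsOpen W
  smooth : ∀ i j, ContDiffOn ℝ ∞ (fun x => g x i j) W
  symm : ∀ x i j, g x i j = g x j i
  det_ne_zero : ∀ x ∈ W, (g x).det ≠ 0

theorem ContDiffOn.matrix_det {ι : Type*} [Fintype ι] [DecidableEq ι] {A : E n → Matrix ι ι ℝ}
    (hA : ∀ i j, ContDiffOn ℝ ∞ (fun x => A x i j) W) :
    ContDiffOn ℝ ∞ (fun x => (A x).det) W := by
  simp_rw [Matrix.det_apply]
  refine ContDiffOn.sum fun σ _ => ?_
  simp_rw [Units.smul_def, zsmul_eq_mul]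
  exact contDiffOn_const.mul (contDiffOn_prod fun i _ => hA _ _)

theorem sum_mul_raised_eq_sqNorm : ∑ i, b i x * raised g b i x = sqNorm g b x := by
  unfold raised sqNorm
  simp_rw [Finset.mul_sum]
  refine Finset.sum_congr rfl fun i _ => Finset.sum_congr rfl fun j _ => ?_
  ring

namespace IsMetricOn

theorem contDiffOn_inv (hg : IsMetricOn g W) (i j : Fin n) :
    ContDiffOn ℝ ∞ (fun x => (g x)⁻¹ i j) W := by
  simp_rw [Matrix.inv_def, Ring.inverse_eq_inv', Matrix.smul_apply, smul_eq_mul,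
    Matrix.adjugate_apply]
  refine ((ContDiffOn.matrix_det hg.smooth).inv hg.det_ne_zero).mul (ContDiffOn.matrix_det ?_)
  intro k l
  simp_rw [Matrix.updateRow_apply]
  split_ifs
  · exact contDiffOn_const
  · exact hg.smooth _ _

theorem inv_symm (hg : IsMetricOn g W) (x : E n) (i j : Fin n) : (g x)⁻¹ i j = (g x)⁻¹ j i := by
  have h : (g x).transpose = g x := by
    ext i j
    exact hg.symm x j i
  conv_lhs => rw [← h, ← Matrix.transpose_nonsing_inv]
  rfl

theorem mulVec_inv_mulVec (hg : IsMetricOn g W) (hx : x ∈ W) (u : Fin n → ℝ) (i : Fin n) :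
    ∑ j, g x i j * ∑ k, (g x)⁻¹ j k * u k = u i := by
  change (g x).mulVec ((g x)⁻¹.mulVec u) i = _
  rw [Matrix.mulVec_mulVec, Matrix.mul_nonsing_inv _ (hg.det_ne_zero x hx).isUnit,
    Matrix.one_mulVec]

theorem sum_mul_raised (hg : IsMetricOn g W) (hx : x ∈ W) (i : Fin n) :
    ∑ j, g x i j * raised g b j x = b i x :=
  hg.mulVec_inv_mulVec hx _ i

theorem contDiffOn_pd_coeff (hg : IsMetricOn g W) (i j k : Fin n) :
    ContDiffOn ℝ ∞ (pd k (fun y => g y i j)) W :=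
  contDiffOn_pd hg.isOpen (hg.smooth i j) k

theorem contDiffOn_chris (hg : IsMetricOn g W) (i j k : Fin n) :
    ContDiffOn ℝ ∞ (chris g i j k) W :=
  contDiffOn_const.mul <| ContDiffOn.sum fun q _ => (hg.contDiffOn_inv i q).mul <|
    ((hg.contDiffOn_pd_coeff k q j).add (hg.contDiffOn_pd_coeff j q k)).sub
      (hg.contDiffOn_pd_coeff j k q)

theorem chris_symm (hg : IsMetricOn g W) (i j k : Fin n) : chris g i j k x = chris g i k j x := by
  unfold chris
  have h : (fun y => g y j k) = fun y => g y k j := funext fun y => hg.symm y j k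
  rw [h]
  congr 1
  refine Finset.sum_congr rfl fun q _ => ?_
  ring

theorem sum_mul_chris (hg : IsMetricOn g W) (hx : x ∈ W) (i j k : Fin n) :
    ∑ d, g x i d * chris g d j k x = (1 / 2) * (pd j (fun y => g y k i) x
      + pd k (fun y => g y j i) x - pd i (fun y => g y j k) x) := by
  have h := hg.mulVec_inv_mulVec hx (fun q => pd j (fun y => g y k q) x
      + pd k (fun y => g y j q) x - pd q (fun y => g y j k) x) i
  rw [← h, Finset.mul_sum]
  refine Finset.sum_congr rfl fun d _ => ?_
  unfold chris
  ring

theorem pd_eq_sum_chris (hg : IsMetricOn g W) (hx : x ∈ W) (q i j : Fin n) :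
    pd q (fun y => g y i j) x
      = ∑ d, g x j d * chris g d q i x + ∑ d, g x i d * chris g d q j x := by
  rw [hg.sum_mul_chris hx, hg.sum_mul_chris hx]
  have h : (fun y => g y i j) = fun y => g y j i := funext fun y => hg.symm y i j
  rw [h]
  ring

/-- The other two derivative terms cancel against the symmetric inverse matrix. What is left is `½
tr(g⁻¹ ∂_i g)`, the logarithmic derivative of `√|det g|`. -/
theorem trace_chris (hg : IsMetricOn g W) (i : Fin n) :
    ∑ k, chris g k i k x = (1 / 2) * ∑ k, ∑ q, (g x)⁻¹ k q * pd i (fun y => g y k q) x := by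
  unfold chris
  rw [← Finset.mul_sum]
  congr 1
  simp_rw [mul_sub, mul_add, Finset.sum_sub_distrib, Finset.sum_add_distrib]
  have : ∑ k, ∑ q, (g x)⁻¹ k q * pd k (fun y => g y i q) x
      = ∑ k, ∑ q, (g x)⁻¹ k q * pd q (fun y => g y i k) x := by
    rw [Finset.sum_comm]
    refine Finset.sum_congr rfl fun k _ => Finset.sum_congr rfl fun q _ => ?_
    rw [hg.inv_symm]
  rw [this]
  ring

/-- Obtained by differentiating `g⁻¹ g = 1`. -/
theorem pd_inv (hg : IsMetricOn g W) (hx : x ∈ W) (j : Fin n) :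
    (Matrix.of fun k q => pd j (fun y => (g y)⁻¹ k q) x)
      = -((g x)⁻¹ * (Matrix.of fun k q => pd j (fun y => g y k q) x) * (g x)⁻¹) := by
  have hu := (hg.det_ne_zero x hx).isUnit
  have hd : ∀ {f : E n → ℝ}, ContDiffOn ℝ ∞ f W → DifferentiableAt ℝ f x := fun hf =>
    (hf.contDiffAt (hg.isOpen.mem_nhds hx)).differentiableAt (by simp)
  have h : (Matrix.of fun k q => pd j (fun y => (g y)⁻¹ k q) x) * g x
      + (g x)⁻¹ * (Matrix.of fun k q => pd j (fun y => g y k q) x) = 0 := by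
    ext k l
    have h0 : pd j (fun y => ∑ q, (g y)⁻¹ k q * g y q l) x = 0 := by
      rw [pd_congr (F' := fun _ => (1 : Matrix (Fin n) (Fin n) ℝ) k l), pd_const]
      filter_upwards [hg.isOpen.mem_nhds hx] with y hy
      rw [← Matrix.nonsing_inv_mul _ (hg.det_ne_zero y hy).isUnit, Matrix.mul_apply]
    rw [pd_sum fun q _ => (hd (hg.contDiffOn_inv k q)).fun_mul (hd (hg.smooth q l))] at h0
    simp_rw [pd_mul (hd (hg.contDiffOn_inv k _)) (hd (hg.smooth _ l))] at h0
    rw [Finset.sum_add_distrib] at h0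
    exact h0
  have h2 := congrArg (· * (g x)⁻¹) (eq_neg_of_add_eq_zero_left h)
  simpa [mul_assoc, Matrix.mul_nonsing_inv _ hu] using h2

/-- Closedness of the trace one-form, without using its potential: its derivative is `½ (-tr(g⁻¹ ∂_j
g g⁻¹ ∂_i g) + tr(g⁻¹ ∂_j ∂_i g))`. The first trace is symmetric in `i, j` by cyclicity, the second
because partial derivatives commute. -/
theorem pd_trace_chris_comm (hg : IsMetricOn g W) (hx : x ∈ W) (i j : Fin n) :
    pd j (fun y => ∑ k, chris g k i k y) x = pd i (fun y => ∑ k, chris g k j k y) x := by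
  have hd : ∀ {f : E n → ℝ}, ContDiffOn ℝ ∞ f W → DifferentiableAt ℝ f x := fun hf =>
    (hf.contDiffAt (hg.isOpen.mem_nhds hx)).differentiableAt (by simp)
  have key : ∀ i j, pd j (fun y => ∑ k, chris g k i k y) x = (1 / 2) *
      (-((g x)⁻¹ * (Matrix.of fun k q => pd j (fun y => g y k q) x) *
        ((g x)⁻¹ * (Matrix.of fun k q => pd i (fun y => g y k q) x))).trace
      + ∑ k, ∑ q, (g x)⁻¹ k q * pd j (pd i (fun y => g y k q)) x) := by
    intro i j
    simp_rw [hg.trace_chris]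
    have hm : ∀ k q, DifferentiableAt ℝ
        (fun y => (g y)⁻¹ k q * pd i (fun y => g y k q) y) x := fun k q =>
      (hd (hg.contDiffOn_inv k q)).fun_mul (hd (hg.contDiffOn_pd_coeff k q i))
    rw [pd_const_mul _ (DifferentiableAt.fun_sum fun k _ => DifferentiableAt.fun_sum fun q _ =>
      hm k q), pd_sum fun k _ => DifferentiableAt.fun_sum fun q _ => hm k q]
    congr 1
    simp_rw [pd_sum fun q _ => hm _ q,
      pd_mul (hd (hg.contDiffOn_inv _ _)) (hd (hg.contDiffOn_pd_coeff _ _ i)),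
      Finset.sum_add_distrib]
    congr 1
    rw [← mul_assoc, ← Matrix.trace_neg, ← Matrix.neg_mul, ← hg.pd_inv hx]
    simp only [Matrix.trace, Matrix.diag, Matrix.mul_apply, Matrix.of_apply]
    refine Finset.sum_congr rfl fun k _ => Finset.sum_congr rfl fun q _ => ?_
    simp_rw [hg.symm _ k q]
  rw [key, key, Matrix.trace_mul_comm]
  congr 2
  refine Finset.sum_congr rfl fun k _ => Finset.sum_congr rfl fun q _ => ?_
  rw [pd_pd_comm ((hg.smooth k q).contDiffAt (hg.isOpen.mem_nhds hx))]

theorem contDiffOn_raised (hg : IsMetricOn g W) (hb : ∀ i, ContDiffOn ℝ ∞ (b i) W) (i : Fin n) :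
    ContDiffOn ℝ ∞ (raised g b i) W :=
  ContDiffOn.sum fun j _ => (hg.contDiffOn_inv i j).mul (hb j)

theorem contDiffOn_sqNorm (hg : IsMetricOn g W) (hb : ∀ i, ContDiffOn ℝ ∞ (b i) W) :
    ContDiffOn ℝ ∞ (sqNorm g b) W :=
  ContDiffOn.sum fun i _ => ContDiffOn.sum fun j _ =>
    ((hg.contDiffOn_inv i j).mul (hb i)).mul (hb j)

/-- This is `∂_i |b|² = 2 bʲ ∇_i b_j`. Differentiating `b_j = g_{jk} bᵏ` expresses `b_k ∂_i bᵏ`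
through `∂_i b_j` and `∂_i g`. The Christoffel term contracts to `½ bʲ bᵏ ∂_i g_{jk}`, since its
other two terms are skew in `j, k`. -/
theorem pd_sqNorm (hg : IsMetricOn g W) (hb : ∀ i, ContDiffOn ℝ ∞ (b i) W) (hx : x ∈ W)
    (i : Fin n) :
    pd i (sqNorm g b) x
      = 2 * ∑ j, raised g b j x * (pd i (b j) x - ∑ d, chris g d i j x * b d x) := by
  have hd : ∀ {f : E n → ℝ}, ContDiffOn ℝ ∞ f W → DifferentiableAt ℝ f x := fun hf =>
    (hf.contDiffAt (hg.isOpen.mem_nhds hx)).differentiableAt (by simp)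
  have hB := fun j => hd (hg.contDiffOn_raised hb j)
  have h1 : pd i (sqNorm g b) x
      = ∑ j, (pd i (b j) x * raised g b j x + b j x * pd i (raised g b j) x) := by
    have : sqNorm g b = fun y => ∑ j, b j y * raised g b j y :=
      funext fun y => sum_mul_raised_eq_sqNorm.symm
    rw [this, pd_sum fun j _ => (hd (hb j)).fun_mul (hB j)]
    simp_rw [pd_mul (hd (hb _)) (hB _)]
  have h2 : ∀ j, pd i (b j) x = ∑ k, (pd i (fun y => g y j k) x * raised g b k x
      + g x j k * pd i (raised g b k) x) := by
    intro j
    rw [pd_congr (F' := fun y => ∑ k, g y j k * raised g b k y),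
      pd_sum fun k _ => (hd (hg.smooth j k)).fun_mul (hB k)]
    · simp_rw [pd_mul (hd (hg.smooth j _)) (hB _)]
    · filter_upwards [hg.isOpen.mem_nhds hx] with y hy
      exact (hg.sum_mul_raised hy j).symm
  have h3 : ∑ j, raised g b j x * pd i (b j) x
      = ∑ j, ∑ k, raised g b j x * raised g b k x * pd i (fun y => g y j k) x
        + ∑ k, b k x * pd i (raised g b k) x := by
    simp_rw [h2, Finset.mul_sum, mul_add, Finset.sum_add_distrib]
    congr 1
    · refine Finset.sum_congr rfl fun j _ => Finset.sum_congr rfl fun k _ => ?_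
      ring
    · rw [Finset.sum_comm]
      refine Finset.sum_congr rfl fun k _ => ?_
      rw [← hg.sum_mul_raised (b := b) hx k, Finset.sum_mul]
      refine Finset.sum_congr rfl fun j _ => ?_
      rw [hg.symm x j k]
      ring
  have h4 : ∀ j, ∑ d, chris g d i j x * b d x
      = ∑ k, raised g b k x * ((1 / 2) * (pd i (fun y => g y j k) x
        + pd j (fun y => g y i k) x - pd k (fun y => g y i j) x)) := by
    intro j
    simp_rw [← hg.sum_mul_chris hx, Finset.mul_sum]
    rw [Finset.sum_comm]
    refine Finset.sum_congr rfl fun d _ => ?_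
    rw [← hg.sum_mul_raised (b := b) hx d, Finset.mul_sum]
    refine Finset.sum_congr rfl fun k _ => ?_
    rw [hg.symm x d k]
    ring
  have h5 : ∑ j, raised g b j x * ∑ d, chris g d i j x * b d x
      = (1 / 2) * ∑ j, ∑ k, raised g b j x * raised g b k x * pd i (fun y => g y j k) x := by
    simp_rw [h4, Finset.mul_sum]
    have : ∑ j, ∑ k, raised g b j x * raised g b k x * pd j (fun y => g y i k) x
        = ∑ j, ∑ k, raised g b j x * raised g b k x * pd k (fun y => g y i j) x := by
      rw [Finset.sum_comm]
      refine Finset.sum_congr rfl fun k _ => Finset.sum_congr rfl fun j _ => ?_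
      ring
    have h6 : ∀ j k, raised g b j x * (raised g b k x * ((1 / 2) * (pd i (fun y => g y j k) x
        + pd j (fun y => g y i k) x - pd k (fun y => g y i j) x)))
        = (1 / 2) * (raised g b j x * raised g b k x * pd i (fun y => g y j k) x)
          + ((1 / 2) * (raised g b j x * raised g b k x * pd j (fun y => g y i k) x)
          - (1 / 2) * (raised g b j x * raised g b k x * pd k (fun y => g y i j) x)) := by
      intro j k
      ring
    simp_rw [h6, Finset.sum_add_distrib, Finset.sum_sub_distrib, ← Finset.mul_sum, this]
    ring
  rw [h1, Finset.sum_add_distrib]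
  simp_rw [mul_sub, Finset.sum_sub_distrib]
  rw [h5]
  simp_rw [mul_comm (pd i (b _) x)]
  linarith

end IsMetricOn

end LocalMetric

/-! ### The affine connection of the Berwald condition and its trace. -/

section BerwaldConnection

variable {n : ℕ} {W : Set (E n)} {g : E n → Matrix (Fin n) (Fin n) ℝ} {b : Fin n → E n → ℝ}
  {c m p : ℝ} {h : E n → ℝ} {x : E n}

/-- The Berwald condition in coordinates. -/
structure IsBerwaldOn (g : E n → Matrix (Fin n) (Fin n) ℝ) (b : Fin n → E n → ℝ) (c m p : ℝ)
    (h : E n → ℝ) (W : Set (E n)) : Prop where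
  metric : IsMetricOn g W
  smooth_form : ∀ i, ContDiffOn ℝ ∞ (b i) W
  smooth_fun : ContDiffOn ℝ ∞ h W
  cov_eq : ∀ x ∈ W, ∀ i j, pd i (b j) x - ∑ d, chris g d i j x * b d x
    = h x * ((c * (1 - p) + m * sqNorm g b x) * b i x * b j x + c * p * sqNorm g b x * g x i j)

/-- The coefficients of the affine connection preserving the Lagrangian. -/
noncomputable def affCoeff (g : E n → Matrix (Fin n) (Fin n) ℝ) (b : Fin n → E n → ℝ) (c m p : ℝ)
    (h : E n → ℝ) (i j k : Fin n) (x : E n) : ℝ :=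
  chris g i j k x + h x * (c * p * raised g b i x * g x j k
    - c * p * (b j x * (if i = k then 1 else 0) + b k x * (if i = j then 1 else 0))
    + m * raised g b i x * b j x * b k x)

namespace IsBerwaldOn

theorem affCoeff_symm (hB : IsBerwaldOn g b c m p h W) (i j k : Fin n) :
    affCoeff g b c m p h i j k x = affCoeff g b c m p h i k j x := by
  unfold affCoeff
  rw [hB.metric.chris_symm, hB.metric.symm x j k]
  ring

theorem contDiffOn_affCoeff (hB : IsBerwaldOn g b c m p h W) (i j k : Fin n) :
    ContDiffOn ℝ ∞ (affCoeff g b c m p h i j k) W := by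
  have h1 := hB.metric.contDiffOn_chris i j k
  have h2 := hB.metric.contDiffOn_raised hB.smooth_form i
  have h3 := hB.metric.smooth j k
  have h4 := hB.smooth_form j
  have h5 := hB.smooth_form k
  have h6 := hB.smooth_fun
  unfold affCoeff
  fun_prop

/-- The right-hand side of the Berwald condition is symmetric, so `b` is closed. -/
theorem pd_form_comm (hB : IsBerwaldOn g b c m p h W) (hx : x ∈ W) (i j : Fin n) :
    pd i (b j) x = pd j (b i) x := by
  have h1 := hB.cov_eq x hx i j
  have h2 := hB.cov_eq x hx j i
  simp_rw [hB.metric.chris_symm _ j i] at h2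
  rw [hB.metric.symm x j i] at h2
  linarith

/-- Contracting the Berwald condition with `bʲ` makes `d|b|²` proportional to `b`, so this term
drops out of any wedge product with `b`. -/
theorem pd_sqNorm (hB : IsBerwaldOn g b c m p h W) (hx : x ∈ W) (i : Fin n) :
    pd i (sqNorm g b) x = 2 * h x * sqNorm g b x * (c + m * sqNorm g b x) * b i x := by
  rw [hB.metric.pd_sqNorm hB.smooth_form hx]
  simp_rw [hB.cov_eq x hx]
  have h1 : ∀ j, raised g b j x * (h x * ((c * (1 - p) + m * sqNorm g b x) * b i x * b j x
      + c * p * sqNorm g b x * g x i j))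
      = h x * (c * (1 - p) + m * sqNorm g b x) * b i x * (b j x * raised g b j x)
        + h x * c * p * sqNorm g b x * (g x i j * raised g b j x) := fun j => by ring
  simp_rw [h1, Finset.sum_add_distrib, ← Finset.mul_sum, sum_mul_raised_eq_sqNorm,
    hB.metric.sum_mul_raised hx]
  ring

theorem trace_affCoeff (hB : IsBerwaldOn g b c m p h W) (hx : x ∈ W) (i : Fin n) :
    ∑ k, affCoeff g b c m p h k i k x
      = ∑ k, chris g k i k x + h x * (m * sqNorm g b x - n * c * p) * b i x := by
  unfold affCoeff
  rw [Finset.sum_add_distrib, ← Finset.mul_sum, Finset.sum_add_distrib, Finset.sum_sub_distrib]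
  have h1 : ∑ k, c * p * raised g b k x * g x i k = c * p * b i x := by
    rw [← hB.metric.sum_mul_raised (b := b) hx i, Finset.mul_sum]
    refine Finset.sum_congr rfl fun k _ => ?_
    ring
  have h2 : ∑ k, m * raised g b k x * b i x * b k x = m * sqNorm g b x * b i x := by
    rw [← sum_mul_raised_eq_sqNorm, Finset.mul_sum, Finset.sum_mul]
    refine Finset.sum_congr rfl fun k _ => ?_
    ring
  -- The trace of the identity contributes `n`. With the other Kronecker delta this gives `-(n+1) c
  -- p b_i`, and `h1` cancels one unit, leaving `-n c p b_i`.
  have h3 : ∑ k : Fin n, c * p * (b i x * (if k = k then 1 else 0)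
      + b k x * (if k = i then 1 else 0)) = c * p * (n * b i x + b i x) := by
    rw [← Finset.mul_sum, Finset.sum_add_distrib]
    simp
  rw [h1, h2, h3]
  ring

/-- The curl of `h (m |b|² - n c p) b` plus the closed Levi-Civita trace. Closedness of `b` and
proportionality of `d|b|²` to `b` leave only the derivative of `h`. -/
theorem pd_trace_affCoeff_sub (hB : IsBerwaldOn g b c m p h W) (hx : x ∈ W) (i j : Fin n) :
    pd i (fun y => ∑ k, affCoeff g b c m p h k j k y) x
      - pd j (fun y => ∑ k, affCoeff g b c m p h k i k y) x
      = (n * c * p - m * sqNorm g b x) * (b i x * pd j h x - b j x * pd i h x) := by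
  have hW := hB.metric.isOpen.mem_nhds hx
  have hd : ∀ {f : E n → ℝ}, ContDiffOn ℝ ∞ f W → DifferentiableAt ℝ f x := fun hf =>
    (hf.contDiffAt hW).differentiableAt (by simp)
  have key : ∀ i j, pd i (fun y => ∑ k, affCoeff g b c m p h k j k y) x
      = pd i (fun y => ∑ k, chris g k j k y) x
        + ((pd i h x * (m * sqNorm g b x - n * c * p) + h x * (m * pd i (sqNorm g b) x)) * b j x
        + h x * (m * sqNorm g b x - n * c * p) * pd i (b j) x) := by
    intro i j
    have hs := hd (hB.metric.contDiffOn_sqNorm hB.smooth_form)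
    have hb := hd (hB.smooth_form j)
    have hh := hd hB.smooth_fun
    rw [pd_congr (F' := fun y => ∑ k, chris g k j k y
        + h y * (m * sqNorm g b y + -(n * c * p)) * b j y)
      (by filter_upwards [hW] with y hy using by rw [hB.trace_affCoeff hy, sub_eq_add_neg]),
      pd_add (DifferentiableAt.fun_sum fun k _ => hd (hB.metric.contDiffOn_chris k j k))
        (by fun_prop),
      pd_mul (by fun_prop) hb, pd_mul hh (by fun_prop), pd_add (by fun_prop) (by fun_prop),
      pd_const_mul _ hs, pd_const]
    ring
  rw [key, key, hB.metric.pd_trace_chris_comm hx, hB.pd_sqNorm hx, hB.pd_sqNorm hx,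
    hB.pd_form_comm hx i j]
  ring

end IsBerwaldOn

end BerwaldConnection


/-- Both readings of the Lagrangian reduce to the form without denominators in `α`, the only one
used afterwards. -/
theorem IsBogoslovskyKropinaValue.eq {c m p α β l : ℝ}
    (hl : IsBogoslovskyKropinaValue c m p α β l) :
    l = (c * α + m * β ^ 2) ^ (p + 1) * (β ^ 2) ^ (-p) := by
  rcases hl with ⟨hα, h1, h2, rfl⟩ | ⟨-, -, rfl⟩
  swap
  · rfl
  -- For `β = 0` and `p ≠ 0` both sides vanish through `0 ^ (-p) = 0`.
  rcases eq_or_ne β 0 with rfl | hβ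
  · rcases eq_or_ne p 0 with rfl | hp
    · simp
      ring
    · simp [Real.zero_rpow (neg_ne_zero.2 hp)]
  have hβ2 : β ^ 2 ≠ 0 := pow_ne_zero 2 hβ
  have hβpos : 0 < β ^ 2 := by positivity
  have hs : c + m * (β ^ 2 / α) = (c * α + m * β ^ 2) / α := by
    field_simp
  rw [hs] at h2 ⊢
  -- For integer `p` the powers are integer powers and `α` cancels whatever its sign. Otherwise
  -- `PowDefined` rules out negative bases, which forces `α > 0` and `ζ ≥ 0`, and the real power
  -- laws apply.
  by_cases hint : ∃ k : ℤ, p = k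
  · obtain ⟨k, rfl⟩ := hint
    have e1 : ((k : ℝ) + 1) = ((k + 1 : ℤ) : ℝ) := by push_cast; ring
    have e2 : (-(k : ℝ)) = ((-k : ℤ) : ℝ) := by push_cast; ring
    rw [e1, e2]
    simp_rw [Real.rpow_intCast]
    rw [div_zpow, div_zpow, zpow_neg, zpow_neg, zpow_add_one₀ hα]
    have := zpow_ne_zero k hα
    have := zpow_ne_zero k hβ2
    field_simp
  · have hnot : ∀ x : ℝ, ¬ (x < 0 ∧ ∃ k : ℤ, -p = k) := by
      rintro x ⟨-, k, hk⟩
      exact hint ⟨-k, by push_cast; linarith⟩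
    have hnot' : ∀ x : ℝ, ¬ (x < 0 ∧ ∃ k : ℤ, p + 1 = k) := by
      rintro x ⟨-, k, hk⟩
      exact hint ⟨k - 1, by push_cast; linarith⟩
    have hαpos : 0 < α := by
      rcases h1 with h1 | ⟨h1, -⟩ | h1
      · exact (div_pos_iff_of_pos_left hβpos).1 h1
      · exact absurd h1 (div_ne_zero hβ2 hα)
      · exact absurd h1 (hnot _)
    have hζ : 0 ≤ c * α + m * β ^ 2 := by
      have : 0 ≤ (c * α + m * β ^ 2) / α := by
        rcases h2 with h2 | ⟨h2, -⟩ | h2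
        · exact h2.le
        · exact h2.ge
        · exact absurd h2 (hnot' _)
      rwa [le_div_iff₀ hαpos, zero_mul] at this
    rw [Real.div_rpow hβpos.le hαpos.le, Real.div_rpow hζ hαpos.le, Real.rpow_add_one hα,
      Real.rpow_neg hαpos.le]
    have := (Real.rpow_pos_of_pos hαpos p).ne'
    field_simp

/-! ### Parallelism of the Bogoslovsky/Kropina Lagrangian. -/

section Lagrangian

variable {n : ℕ} {W : Set (E n)} {U : Set (E n × E n)} {g : E n → Matrix (Fin n) (Fin n) ℝ}
  {b : Fin n → E n → ℝ} {c m p : ℝ} {h : E n → ℝ} {L : E n → E n → ℝ} {x v : E n}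

/-- The quadratic form `g_{ij} ẋⁱ ẋʲ`. -/
noncomputable def quad (g : E n → Matrix (Fin n) (Fin n) ℝ) (x v : E n) : ℝ := ∑ i, ∑ j, g x i j * v i * v j

/-- The linear form `b_i ẋⁱ`. -/
noncomputable def lin (b : Fin n → E n → ℝ) (x v : E n) : ℝ := ∑ i, b i x * v i

/-- The quadratic form `c g + m b ⊗ b`. -/
noncomputable def mixed (g : E n → Matrix (Fin n) (Fin n) ℝ) (b : Fin n → E n → ℝ) (c m : ℝ) (x v : E n) : ℝ :=
  c * quad g x v + m * lin b x v ^ 2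

/-- The vector `(∂_q, -Gᵇ_{qc} ẋᶜ ∂̇_b)` tangent to phase space. -/
noncomputable def horVec (G : Fin n → Fin n → Fin n → E n → ℝ) (q : Fin n) (x v : E n) : E n × E n :=
  (stdVec q, -∑ d, nonlin G d q x v • stdVec d)

/-- The horizontal derivative becomes a single directional derivative, so the chain and product
rules apply to powers of `mixed` and `lin` at once. -/
theorem fderiv_horVec {F : E n → E n → ℝ} (hF : DifferentiableAt ℝ (unc F) (x, v))
    (G : Fin n → Fin n → Fin n → E n → ℝ) (q : Fin n) :
    fderiv ℝ (unc F) (x, v) (horVec G q x v)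
      = dx q F x v - ∑ d, nonlin G d q x v * dv d F x v := by
  have h : horVec G q x v
      = (stdVec q, (0 : E n)) - ∑ d, nonlin G d q x v • ((0 : E n), stdVec d) := by
    refine Prod.ext ?_ ?_
    · simp [horVec, Prod.fst_sum]
    · simp [horVec, Prod.snd_sum]
  rw [h, map_sub, map_sum, dx_eq_fderiv hF]
  simp_rw [map_smul, dv_eq_fderiv hF, smul_eq_mul]

theorem continuous_lin : Continuous (lin b x) := by
  unfold lin
  fun_prop

theorem pd_lin (i : Fin n) : pd i (lin b x) v = b i x := by
  change pd i (fun v : E n => ∑ k, b k x * v k) v = _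
  rw [pd_sum fun k _ => (differentiableAt_coord k).const_mul _]
  simp_rw [pd_const_mul _ (differentiableAt_coord _), pd_coord]
  simp

/-- The fibre Hessian of a multiple of the square of a linear form has rank at most one.
Nondegeneracy therefore forbids `L` from having this form on an open set of velocities. -/
theorem det_lMetric_eq_zero (hn : 2 ≤ n) {k : ℝ}
    (hL : ∀ᶠ w in 𝓝 v, L x w = k * lin b x w ^ 2) : (lMetric L x v).det = 0 := by
  have hd : ∀ w, DifferentiableAt ℝ (lin b x) w := fun w => by
    unfold lin
    fun_prop
  have h1 : ∀ j w, pd j (fun w => k * lin b x w ^ 2) w = 2 * k * b j x * lin b x w := by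
    intro j w
    simp_rw [pow_two]
    rw [pd_const_mul _ ((hd w).fun_mul (hd w)), pd_mul (hd w) (hd w), pd_lin]
    ring
  have : Nontrivial (Fin n) := Fin.nontrivial_iff_two_le.2 hn
  have h2 : lMetric L x v = Matrix.vecMulVec (fun i => k * b i x) (fun j => b j x) := by
    ext i j
    have h3 : dv j L x =ᶠ[𝓝 v] fun w => 2 * k * b j x * lin b x w := by
      filter_upwards [hL.eventually_nhds] with w hw
      rw [← h1 j w]
      exact pd_congr hw
    simp only [lMetric, Matrix.of_apply, Matrix.vecMulVec_apply]
    change (1 / 2) * pd i (dv j L x) v = _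
    rw [pd_congr h3, pd_const_mul _ (hd v), pd_lin]
    ring
  rw [h2, Matrix.det_vecMulVec]

namespace IsBerwaldOn

theorem nonlin_affCoeff (d q : Fin n) :
    nonlin (affCoeff g b c m p h) d q x v = nonlin (chris g) d q x v
      + h x * (c * p * raised g b d x * (∑ i, g x q i * v i)
        - c * p * (b q x * v d + lin b x v * (if d = q then 1 else 0))
        + m * raised g b d x * b q x * lin b x v) := by
  unfold nonlin affCoeff lin
  have h1 : ∀ i, (chris g d q i x + h x * (c * p * raised g b d x * g x q i
      - c * p * (b q x * (if d = i then 1 else 0) + b i x * (if d = q then 1 else 0))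
      + m * raised g b d x * b q x * b i x)) * v i
      = chris g d q i x * v i + (h x * (c * p * raised g b d x) * (g x q i * v i)
        - (h x * (c * p) * b q x * ((if d = i then 1 else 0) * v i)
          + h x * (c * p) * (if d = q then 1 else 0) * (b i x * v i))
        + h x * (m * raised g b d x * b q x) * (b i x * v i)) := by
    intro i
    ring
  simp_rw [h1, Finset.sum_add_distrib, Finset.sum_sub_distrib, Finset.sum_add_distrib,
    ← Finset.mul_sum]
  have h2 : ∑ i, (if d = i then (1 : ℝ) else 0) * v i = v d := by simp
  rw [h2]
  ring

theorem contDiffOn_lin (hB : IsBerwaldOn g b c m p h W) :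
    ContDiffOn ℝ ∞ (unc (lin b)) (W ×ˢ univ) := by
  refine ContDiffOn.sum fun i _ => ContDiffOn.mul
    ((hB.smooth_form i).comp contDiffOn_fst fun z hz => hz.1) ?_
  exact ContDiff.contDiffOn (by fun_prop)

theorem contDiffOn_quad (hB : IsBerwaldOn g b c m p h W) :
    ContDiffOn ℝ ∞ (unc (quad g)) (W ×ˢ univ) := by
  refine ContDiffOn.sum fun i _ => ContDiffOn.sum fun j _ => ContDiffOn.mul (ContDiffOn.mul
    ((hB.metric.smooth i j).comp contDiffOn_fst fun z hz => hz.1) ?_) ?_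
  · exact ContDiff.contDiffOn (by fun_prop)
  · exact ContDiff.contDiffOn (by fun_prop)

theorem differentiableAt_lin (hB : IsBerwaldOn g b c m p h W) (hx : x ∈ W) :
    DifferentiableAt ℝ (unc (lin b)) (x, v) :=
  differentiableAt_of_mem (hB.metric.isOpen.prod isOpen_univ) hB.contDiffOn_lin ⟨hx, mem_univ _⟩

theorem differentiableAt_quad (hB : IsBerwaldOn g b c m p h W) (hx : x ∈ W) :
    DifferentiableAt ℝ (unc (quad g)) (x, v) :=
  differentiableAt_of_mem (hB.metric.isOpen.prod isOpen_univ) hB.contDiffOn_quad ⟨hx, mem_univ _⟩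

/-- The Levi-Civita part gives `ẋⁱ ∇_q b_i`. The raised-`b` terms of `affCoeff` cancel everything in
it containing `|b|²`, and the Kronecker terms raise `c (1-p)` to `c (1-p) + 2 c p = c (1+p)`. -/
theorem fderiv_lin_horVec (hB : IsBerwaldOn g b c m p h W) (hx : x ∈ W) (q : Fin n) :
    fderiv ℝ (unc (lin b)) (x, v) (horVec (affCoeff g b c m p h) q x v)
      = h x * c * (1 + p) * b q x * lin b x v := by
  have hW := hB.metric.isOpen.mem_nhds hx
  have hd : ∀ i, DifferentiableAt ℝ (b i) x := fun i =>
    ((hB.smooth_form i).contDiffAt hW).differentiableAt (by simp)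
  have hdx : dx q (lin b) x v = ∑ i, pd q (b i) x * v i := by
    change pd q (fun y => ∑ i, b i y * v i) x = _
    rw [pd_sum fun i _ => (hd i).mul_const _]
    refine Finset.sum_congr rfl fun i _ => ?_
    rw [pd_mul (hd i) (differentiableAt_const _), pd_const]
    ring
  have hdv : ∀ d, dv d (lin b) x v = b d x := fun d => pd_lin d
  rw [fderiv_horVec (hB.differentiableAt_lin hx), hdx]
  simp_rw [hdv, nonlin_affCoeff]
  have h1 : ∑ d, nonlin (chris g) d q x v * b d x
      = ∑ i, (∑ d, chris g d q i x * b d x) * v i := by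
    unfold nonlin
    simp_rw [Finset.sum_mul]
    rw [Finset.sum_comm]
    refine Finset.sum_congr rfl fun i _ => Finset.sum_congr rfl fun d _ => ?_
    ring
  have h2 : ∑ i, pd q (b i) x * v i - ∑ i, (∑ d, chris g d q i x * b d x) * v i
      = h x * ((c * (1 - p) + m * sqNorm g b x) * b q x * lin b x v
        + c * p * sqNorm g b x * ∑ i, g x q i * v i) := by
    rw [← Finset.sum_sub_distrib]
    simp_rw [← sub_mul, hB.cov_eq x hx]
    unfold lin
    rw [Finset.mul_sum, Finset.mul_sum, ← Finset.sum_add_distrib, Finset.mul_sum]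
    refine Finset.sum_congr rfl fun i _ => ?_
    ring
  have h3 : ∀ d, (nonlin (chris g) d q x v
      + h x * (c * p * raised g b d x * (∑ i, g x q i * v i)
        - c * p * (b q x * v d + lin b x v * (if d = q then 1 else 0))
        + m * raised g b d x * b q x * lin b x v)) * b d x
      = nonlin (chris g) d q x v * b d x
        + ((h x * (c * p * (∑ i, g x q i * v i) + m * b q x * lin b x v))
          * (b d x * raised g b d x)
        - (h x * c * p * b q x * (b d x * v d)
          + h x * c * p * lin b x v * ((if d = q then 1 else 0) * b d x))) := by
    intro d
    ring
  simp_rw [h3, Finset.sum_add_distrib, Finset.sum_sub_distrib, Finset.sum_add_distrib,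
    ← Finset.mul_sum, sum_mul_raised_eq_sqNorm, ← sub_sub]
  rw [h1, h2]
  have h4 : ∑ i, (if i = q then (1 : ℝ) else 0) * b i x = b q x := by simp
  have h5 : ∑ i, b i x * v i = lin b x v := rfl
  rw [h4, h5]
  ring

/-- The Levi-Civita part preserves the quadratic form. In the correction, the terms in `g_{qi} ẋⁱ`
from the raised `b` and from the Kronecker delta cancel. -/
theorem fderiv_quad_horVec (hB : IsBerwaldOn g b c m p h W) (hx : x ∈ W) (q : Fin n) :
    fderiv ℝ (unc (quad g)) (x, v) (horVec (affCoeff g b c m p h) q x v)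
      = 2 * h x * b q x * (c * p * quad g x v - m * lin b x v ^ 2) := by
  have hW := hB.metric.isOpen.mem_nhds hx
  have hd : ∀ i j, DifferentiableAt ℝ (fun y => g y i j) x := fun i j =>
    ((hB.metric.smooth i j).contDiffAt hW).differentiableAt (by simp)
  have hdx : dx q (quad g) x v = ∑ i, ∑ j, pd q (fun y => g y i j) x * v i * v j := by
    change pd q (fun y => ∑ i, ∑ j, g y i j * v i * v j) x = _
    have hd2 := fun i j => ((hd i j).mul_const (v i)).mul_const (v j)
    rw [pd_sum fun i _ => DifferentiableAt.fun_sum fun j _ => hd2 i j]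
    simp_rw [pd_sum fun j _ => hd2 _ j, mul_assoc,
      pd_mul (hd _ _) (differentiableAt_const _), pd_const]
    simp
  have hdv : ∀ d, dv d (quad g) x v = 2 * ∑ j, g x d j * v j := by
    intro d
    change pd d (fun w => ∑ i, ∑ j, g x i j * w i * w j) v = _
    have hc := fun i : Fin n => differentiableAt_coord (y := v) i
    have hd2 := fun i j => ((hc i).const_mul (g x i j)).fun_mul (hc j)
    rw [pd_sum fun i _ => DifferentiableAt.fun_sum fun j _ => hd2 i j]
    simp_rw [pd_sum fun j _ => hd2 _ j, pd_mul ((hc _).const_mul (g x _ _)) (hc _),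
      pd_const_mul _ (hc _), pd_coord, Finset.sum_add_distrib]
    simp only [mul_ite, mul_one, mul_zero, ite_mul, zero_mul, Finset.sum_ite_eq', Finset.mem_univ,
      if_true]
    rw [Finset.sum_comm]
    simp only [Finset.sum_ite_eq', Finset.mem_univ, if_true]
    rw [two_mul]
    congr 1
    refine Finset.sum_congr rfl fun j _ => ?_
    rw [hB.metric.symm x j d]
  rw [fderiv_horVec (hB.differentiableAt_quad hx), hdx]
  simp_rw [hdv, nonlin_affCoeff]
  set lo : Fin n → ℝ := fun q => ∑ i, g x q i * v i with hlo
  change _ - ∑ d, (nonlin (chris g) d q x v + h x * (c * p * raised g b d x * lo q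
    - c * p * (b q x * v d + lin b x v * (if d = q then 1 else 0))
    + m * raised g b d x * b q x * lin b x v)) * (2 * lo d) = _
  have h1 : ∑ i, ∑ j, pd q (fun y => g y i j) x * v i * v j
      = ∑ d, nonlin (chris g) d q x v * (2 * lo d) := by
    have e1 : ∑ i, ∑ j, (∑ d, g x i d * chris g d q j x) * v i * v j
        = ∑ d, nonlin (chris g) d q x v * lo d := by
      simp only [hlo, nonlin, Finset.sum_mul, Finset.mul_sum]
      rw [Finset.sum_comm_cycle]
      refine Finset.sum_congr rfl fun d _ => ?_
      refine Finset.sum_congr rfl fun i _ => Finset.sum_congr rfl fun j _ => ?_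
      rw [hB.metric.symm x i d]
      ring
    have e2 : ∑ i, ∑ j, (∑ d, g x j d * chris g d q i x) * v i * v j
        = ∑ d, nonlin (chris g) d q x v * lo d := by
      rw [← e1, Finset.sum_comm]
      refine Finset.sum_congr rfl fun i _ => Finset.sum_congr rfl fun j _ => ?_
      ring
    simp_rw [hB.metric.pd_eq_sum_chris hx, add_mul, Finset.sum_add_distrib]
    rw [e1, e2, ← Finset.sum_add_distrib]
    refine Finset.sum_congr rfl fun d _ => ?_
    ring
  have h2 : ∑ d, raised g b d x * lo d = lin b x v := by
    simp only [hlo, lin, Finset.mul_sum]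
    rw [Finset.sum_comm]
    refine Finset.sum_congr rfl fun i _ => ?_
    rw [← hB.metric.sum_mul_raised (b := b) hx i, Finset.sum_mul]
    refine Finset.sum_congr rfl fun d _ => ?_
    rw [hB.metric.symm x d i]
    ring
  have h3 : ∑ d, v d * lo d = quad g x v := by
    simp only [hlo, quad, Finset.mul_sum]
    refine Finset.sum_congr rfl fun i _ => Finset.sum_congr rfl fun j _ => ?_
    ring
  have h4 : ∑ d, (if d = q then (1 : ℝ) else 0) * lo d = lo q := by simp
  have h5 : ∀ d, (nonlin (chris g) d q x v + h x * (c * p * raised g b d x * lo q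
      - c * p * (b q x * v d + lin b x v * (if d = q then 1 else 0))
      + m * raised g b d x * b q x * lin b x v)) * (2 * lo d)
      = nonlin (chris g) d q x v * (2 * lo d)
        + ((2 * h x * (c * p * lo q + m * b q x * lin b x v)) * (raised g b d x * lo d)
        - (2 * h x * c * p * b q x * (v d * lo d)
          + 2 * h x * c * p * lin b x v * ((if d = q then 1 else 0) * lo d))) := by
    intro d
    ring
  simp_rw [h5, Finset.sum_add_distrib, Finset.sum_sub_distrib, Finset.sum_add_distrib,
    ← Finset.mul_sum]
  rw [h1, h2, h3, h4]
  ring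

/-- Neither the quadratic form nor this combination is preserved, but here the `lin²` terms add up
to `c m (-1 + (1+p)) = c m p`, matching the factor of the quadratic form. -/
theorem hasFDerivAt_mixed (hB : IsBerwaldOn g b c m p h W) (hx : x ∈ W) :
    ∃ D : E n × E n →L[ℝ] ℝ, HasFDerivAt (unc (mixed g b c m)) D (x, v) ∧
      ∀ q, D (horVec (affCoeff g b c m p h) q x v)
        = 2 * c * p * h x * b q x * mixed g b c m x v := by
  have h1 := (hB.differentiableAt_quad (v := v) hx).hasFDerivAt
  have h2 := (hB.differentiableAt_lin (v := v) hx).hasFDerivAt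
  refine ⟨_, (h1.const_mul c).add ((h2.pow 2).const_mul m), fun q => ?_⟩
  simp only [add_apply, smul_apply, smul_eq_mul, hB.fderiv_quad_horVec hx,
    hB.fderiv_lin_horVec hx, mixed]
  simp
  ring

/-- Where `lin` and `mixed` are nonzero, the exponents `p+1` and `-2p` balance the two horizontal
rates. Nondegeneracy makes such velocities dense in each fibre of `U`, and continuity extends the
identity to all of `U`. -/
theorem isParallel (hB : IsBerwaldOn g b c m p h W) (hn : 2 ≤ n) (hU : IsOpen U)
    (hUW : ∀ x v, (x, v) ∈ U → x ∈ W) (hL : ContDiffOn ℝ ∞ (unc L) U)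
    (hLeq : ∀ x v, (x, v) ∈ U →
      L x v = mixed g b c m x v ^ (p + 1) * (lin b x v ^ 2) ^ (-p))
    (hdet : ∀ x v, (x, v) ∈ U → (lMetric L x v).det ≠ 0) :
    IsParallel (affCoeff g b c m p h) L U := by
  intro x v hz q
  have hx := hUW x v hz
  have hev : ∀ v, (x, v) ∈ U →
      unc L =ᶠ[𝓝 (x, v)] fun z => unc (mixed g b c m) z ^ (p + 1) * (unc (lin b) z ^ 2) ^ (-p) :=
    fun v hz => by
      filter_upwards [hU.mem_nhds hz] with z hz using hLeq z.1 z.2 hz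
  rcases eq_or_ne p 0 with rfl | hp
  -- For `p = 0` the Lagrangian is `mixed` itself, whose horizontal derivative carries the factor
  -- `p`.
  · obtain ⟨D, hD, hDq⟩ := hB.hasFDerivAt_mixed (v := v) hx
    have hF : unc L =ᶠ[𝓝 (x, v)] unc (mixed g b c m) := (hev v hz).trans (by simp)
    have := fderiv_horVec (differentiableAt_of_mem hU hL hz) (affCoeff g b c m 0 h) q
    rw [hF.fderiv_eq, hD.fderiv, hDq] at this
    linarith
  have hgen : ∀ v, (x, v) ∈ U → lin b x v ≠ 0 → mixed g b c m x v ≠ 0 →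
      dx q L x v - ∑ d, nonlin (affCoeff g b c m p h) d q x v * dv d L x v = 0 := by
    intro v hz hl hm
    obtain ⟨D, hD, hDq⟩ := hB.hasFDerivAt_mixed (v := v) hx
    have hl2 : lin b x v ^ 2 ≠ 0 := pow_ne_zero 2 hl
    have h2 := (hB.differentiableAt_lin (v := v) hx).hasFDerivAt
    have h3 := (hD.rpow_const (p := p + 1) (Or.inl hm)).mul
      ((h2.pow 2).rpow_const (p := -p) (Or.inl hl2))
    rw [← fderiv_horVec (differentiableAt_of_mem hU hL hz), (hev v hz).fderiv_eq]
    erw [h3.fderiv]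
    simp only [add_apply, smul_apply, smul_eq_mul, hDq, hB.fderiv_lin_horVec hx]
    change mixed g b c m x v ^ (p + 1) * ((-p * (lin b x v ^ 2) ^ (-p - 1))
        * ((2 • lin b x v ^ (2 - 1)) * (h x * c * (1 + p) * b q x * lin b x v)))
      + (lin b x v ^ 2) ^ (-p) * (((p + 1) * mixed g b c m x v ^ (p + 1 - 1))
        * (2 * c * p * h x * b q x * mixed g b c m x v)) = 0
    -- `mixed` may be negative here; this power law only needs a nonzero base.
    have e1 : mixed g b c m x v ^ (p + 1) = mixed g b c m x v ^ p * mixed g b c m x v :=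
      Real.rpow_add_one hm p
    have e2 : (lin b x v ^ 2) ^ (-p) = (lin b x v ^ 2) ^ (-p - 1) * lin b x v ^ 2 := by
      rw [← Real.rpow_add_one hl2, sub_add_cancel]
    rw [e1, e2, add_sub_cancel_right]
    simp only [nsmul_eq_mul, Nat.cast_ofNat]
    ring
  have hfl : ∀ v, (x, v) ∈ U → ∃ᶠ w in 𝓝 v, lin b x w ≠ 0 := by
    intro v hz hnot
    refine hdet x v hz (det_lMetric_eq_zero (b := b) (k := 0) hn ?_)
    filter_upwards [hnot, eventually_fiber hU hz] with w hw hwU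
    rw [hLeq x w hwU, not_not.1 hw]
    simp [Real.zero_rpow (neg_ne_zero.2 hp)]
  have hfm : ∀ v, (x, v) ∈ U → ∃ᶠ w in 𝓝 v, mixed g b c m x w ≠ 0 := by
    intro v hz hnot
    -- If `mixed` vanished near `v`, `L` would be `0` there, except for `p = -1`, where `0 ^ 0 = 1`
    -- makes it `lin²`. The constant `0 ^ (p + 1)` covers both cases.
    refine hdet x v hz (det_lMetric_eq_zero (b := b) (k := (0 : ℝ) ^ (p + 1)) hn ?_)
    filter_upwards [hnot, eventually_fiber hU hz] with w hw hwU
    rw [hLeq x w hwU, not_not.1 hw]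
    rcases eq_or_ne (p + 1) 0 with h0 | h0
    · have : -p = 1 := by linarith
      simp [this]
    · simp [Real.zero_rpow h0]
  rw [← sub_eq_zero]
  by_contra hne
  have hcont : ContinuousAt
      (fun w => dx q L x w - ∑ d, nonlin (affCoeff g b c m p h) d q x w * dv d L x w) v := by
    refine ContinuousAt.sub (differentiableAt_fiber hU (contDiffOn_dx hU hL q) hz).continuousAt
      (tendsto_finsetSum _ fun d _ => ContinuousAt.mul
        (differentiableAt_nonlin d q).continuousAt
        (differentiableAt_fiber hU (contDiffOn_dv hU hL d) hz).continuousAt)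
  have hev1 := (hcont.eventually_ne hne).and (eventually_fiber hU hz)
  -- First move to `w` with `lin ≠ 0`, an open condition, then from `w` to a nearby `u` where `mixed
  -- ≠ 0` as well. The expression is still nonzero at `u`, contradicting `hgen`.
  obtain ⟨w, hw, hw1⟩ := ((hfl v hz).and_eventually hev1.eventually_nhds).exists
  obtain ⟨u, hu, hu1, hu2⟩ := ((hfm w hw1.self_of_nhds.2).and_eventually
    (hw1.and (continuous_lin.continuousAt.eventually_ne hw))).exists
  exact hu1.1 (hgen u hu1.2 hu2 hu)

end IsBerwaldOn

end Lagrangian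


/-! ### Transfer of the local results to the Finsler spacetime. -/

section Charts

variable {n : ℕ} {M : Type*} [TopologicalSpace M] [ChartedSpace (E n) M] [IsManifold (𝓡 n) ∞ M]
  {α : PseudoRiemannianMetric n M} {β : OneForm n M} {c m p : ℝ} {H : M → ℝ}
  {S : FinslerSpacetime n M} {e : OpenPartialHomeomorph M (E n)} {x v : E n}

theorem PseudoRiemannianMetric.isMetricOn (α : PseudoRiemannianMetric n M) (he : e ∈ charts n M) :
    IsMetricOn (α.comp e) e.target :=
  ⟨e.open_target, α.contDiffOn_comp he, α.comp_symm, fun _ hx => α.det_comp_ne_zero he hx⟩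

theorem BerwaldCondition.isBerwaldOn (hB : BerwaldCondition α β c m p H)
    (hH : ContMDiff (𝓡 n) 𝓘(ℝ) ∞ H) (he : e ∈ charts n M) :
    IsBerwaldOn (α.comp e) (β.comp e) c m p (fun y => H (e.symm y)) e.target :=
  ⟨α.isMetricOn he, β.contDiffOn_comp he, contDiffOn_comp_symm hH he,
    fun x hx i j => hB e he x hx i j⟩

/-- The admissible vectors in the coordinates of a chart. -/
def FinslerSpacetime.chartDomain (S : FinslerSpacetime n M)
    (e : OpenPartialHomeomorph M (E n)) : Set (E n × E n) :=
  {z | InChart e S.A z.1 z.2}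

theorem FinslerSpacetime.isParallel_affCoeff (hn : 2 ≤ n)
    (hL : S.IsBogoslovskyKropina α β c m p) (hH : ContMDiff (𝓡 n) 𝓘(ℝ) ∞ H)
    (hB : BerwaldCondition α β c m p H) (he : e ∈ charts n M) :
    IsParallel (affCoeff (α.comp e) (β.comp e) c m p fun y => H (e.symm y)) (loc e S.L)
      (S.chartDomain e) := by
  refine (hB.isBerwaldOn hH he).isParallel hn (isOpen_inChart he S.conic.isOpen)
    (fun x v hz => hz.1) (contDiffOn_loc he S.smooth) (fun x v hz => ?_)
    fun x v hz => S.nondegenerate e he x v hz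
  have h := (hL _ hz.2).eq
  change S.L (tpoint e x v) = (c * α.val (e.symm x) (tvec e x v) (tvec e x v)
    + m * β.val (e.symm x) (tvec e x v) ^ 2) ^ (p + 1)
    * (β.val (e.symm x) (tvec e x v) ^ 2) ^ (-p) at h
  rw [α.val_tvec, β.val_tvec] at h
  exact h

theorem FinslerSpacetime.spray_eq (hn : 2 ≤ n)
    (hL : S.IsBogoslovskyKropina α β c m p) (hH : ContMDiff (𝓡 n) 𝓘(ℝ) ∞ H)
    (hB : BerwaldCondition α β c m p H) (he : e ∈ charts n M) (hz : InChart e S.A x v)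
    (i : Fin n) :
    spray (loc e S.L) i x v = (1 / 2) * ∑ j, nonlin
      (affCoeff (α.comp e) (β.comp e) c m p fun y => H (e.symm y)) i j x v * v j :=
  (S.isParallel_affCoeff hn hL hH hB he).spray_eq (isOpen_inChart he S.conic.isOpen)
    (contDiffOn_loc he S.smooth) (fun _ _ _ i j k => (hB.isBerwaldOn hH he).affCoeff_symm i j k)
    (fun x v hz => S.nondegenerate e he x v hz) hz i

theorem FinslerSpacetime.chernRund_eq (hn : 2 ≤ n)
    (hL : S.IsBogoslovskyKropina α β c m p) (hH : ContMDiff (𝓡 n) 𝓘(ℝ) ∞ H)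
    (hB : BerwaldCondition α β c m p H) (he : e ∈ charts n M) (hz : InChart e S.A x v)
    (i j k : Fin n) :
    chernRund (loc e S.L) i j k x v
      = affCoeff (α.comp e) (β.comp e) c m p (fun y => H (e.symm y)) i j k x :=
  (S.isParallel_affCoeff hn hL hH hB he).chernRund_eq (isOpen_inChart he S.conic.isOpen)
    (contDiffOn_loc he S.smooth) (fun _ _ _ i j k => (hB.isBerwaldOn hH he).affCoeff_symm i j k)
    (fun x v hz => S.nondegenerate e he x v hz) hz i j k

theorem FinslerSpacetime.chernRundRicci_sub (hn : 2 ≤ n)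
    (hL : S.IsBogoslovskyKropina α β c m p) (hH : ContMDiff (𝓡 n) 𝓘(ℝ) ∞ H)
    (hB : BerwaldCondition α β c m p H) (he : e ∈ charts n M) (hz : InChart e S.A x v)
    (a b : Fin n) :
    chernRundRicci (loc e S.L) a b x v - chernRundRicci (loc e S.L) b a x v
      = (n * c * p - m * normSq α β e x) * wedgeD β H e a b x := by
  have hB' := hB.isBerwaldOn hH he
  rw [(S.isParallel_affCoeff hn hL hH hB he).chernRundRicci_sub
    (isOpen_inChart he S.conic.isOpen) (contDiffOn_loc he S.smooth)
    (fun _ _ _ i j k => hB'.affCoeff_symm i j k) (fun x v hz => S.nondegenerate e he x v hz) hz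
    (fun i j k => ((hB'.contDiffOn_affCoeff i j k).contDiffAt
      (e.open_target.mem_nhds hz.1)).differentiableAt (by simp)) a b,
    hB'.pd_trace_affCoeff_sub hz.1]
  rfl

/-- A metrizing `g` would have `affCoeff` as its Christoffel symbols, whose trace is closed; the
curl of the trace of `affCoeff` was computed to be the left-hand side. -/
theorem FinslerSpacetime.mul_wedgeD_eq_zero_of_isMetrizable (hn : 2 ≤ n)
    (hL : S.IsBogoslovskyKropina α β c m p) (hH : ContMDiff (𝓡 n) 𝓘(ℝ) ∞ H)
    (hB : BerwaldCondition α β c m p H) (hS : S.IsMetrizable) (he : e ∈ charts n M)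
    (hx : x ∈ e.target) (a b : Fin n) :
    (n * c * p - m * normSq α β e x) * wedgeD β H e a b x = 0 := by
  obtain ⟨g, hg⟩ := hS
  have h : ∀ i, pd b (fun y => ∑ k, affCoeff (α.comp e) (β.comp e) c m p
      (fun y => H (e.symm y)) k i k y) x = pd b (fun y => ∑ k, chris (g.comp e) k i k y) x
      ∧ pd a (fun y => ∑ k, affCoeff (α.comp e) (β.comp e) c m p
      (fun y => H (e.symm y)) k i k y) x = pd a (fun y => ∑ k, chris (g.comp e) k i k y) x := by
    intro i
    have hev : (fun y => ∑ k, affCoeff (α.comp e) (β.comp e) c m p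
        (fun y => H (e.symm y)) k i k y) =ᶠ[𝓝 x] fun y => ∑ k, chris (g.comp e) k i k y := by
      filter_upwards [e.open_target.mem_nhds hx] with y hy
      -- Metrizability speaks only of admissible vectors. Since these project onto `M`, the two sets
      -- of coefficients agree at every point of the chart and can be differentiated.
      obtain ⟨v, hv⟩ := S.conic.exists_inChart he hy
      refine Finset.sum_congr rfl fun k _ => ?_
      rw [← S.chernRund_eq hn hL hH hB he hv, hg e he y v hv]
      rfl
    exact ⟨pd_congr hev, pd_congr hev⟩
  have key := (hB.isBerwaldOn hH he).pd_trace_affCoeff_sub hx a b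
  rw [(h a).1, (h b).2, (g.isMetricOn he).pd_trace_chris_comm hx, sub_self] at key
  exact key.symm

end Charts

end BerwaldSpacetime

theorem proposition1 {M : Type*} [TopologicalSpace M]
    [ChartedSpace (BerwaldSpacetime.E 4) M] [IsManifold (𝓡 4) ∞ M]
    (α : BerwaldSpacetime.PseudoRiemannianMetric 4 M) (β : BerwaldSpacetime.OneForm 4 M)
    (c m p : ℝ) (S : BerwaldSpacetime.FinslerSpacetime 4 M)
    (hL : S.IsBogoslovskyKropina α β c m p)
    (H : M → ℝ) (hH : ContMDiff (𝓡 4) 𝓘(ℝ) ∞ H)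
    (hB : BerwaldSpacetime.BerwaldCondition α β c m p H) :
    S.IsBerwald ∧
    (∀ e ∈ BerwaldSpacetime.charts 4 M, ∀ x v, BerwaldSpacetime.InChart e S.A x v →
      ∀ a b : Fin 4,
        (1 / 2) * (BerwaldSpacetime.chernRundRicci (BerwaldSpacetime.loc e S.L) a b x v
          - BerwaldSpacetime.chernRundRicci (BerwaldSpacetime.loc e S.L) b a x v)
        = BerwaldSpacetime.skewFactor α β c m p e x * BerwaldSpacetime.wedgeD β H e a b x) ∧
    ((∃ e ∈ BerwaldSpacetime.charts 4 M, ∃ x ∈ e.target,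
        BerwaldSpacetime.skewFactor α β c m p e x ≠ 0 ∧
        ∃ a b : Fin 4, BerwaldSpacetime.wedgeD β H e a b x ≠ 0) →
      ¬ S.IsMetrizable) := by
  have hn : 2 ≤ 4 := by norm_num
  refine ⟨fun e he => ?_, fun e he x v hz a b => ?_, ?_⟩
  · refine ⟨BerwaldSpacetime.affCoeff (α.comp e) (β.comp e) c m p fun y => H (e.symm y),
      fun x v hz a => ?_⟩
    rw [S.spray_eq hn hL hH hB he hz]
    simp_rw [BerwaldSpacetime.nonlin, Finset.sum_mul]
    congr 1
    refine Finset.sum_congr rfl fun i _ => Finset.sum_congr rfl fun j _ => ?_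
    ring
  -- The constant `4` in `f` is the dimension: `n c p` at `n = 4`.
  · rw [S.chernRundRicci_sub hn hL hH hB he hz, BerwaldSpacetime.skewFactor]
    push_cast
    ring
  · rintro ⟨e, he, x, hx, hf, a, b, hw⟩ hS
    have h := S.mul_wedgeD_eq_zero_of_isMetrizable hn hL hH hB hS he hx a b
    refine hf ?_
    rw [BerwaldSpacetime.skewFactor]
    have := (mul_eq_zero.1 h).resolve_right hw
    push_cast at this
    rw [this, mul_zero]
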